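/- Let $d\ge 1$, let $\mathcal X$ be a measurable space with base measure $\nu$, let $\Theta\subseteq\mathbb R^d$, let $f(x;\theta)$ be a family of densities with respect to $\nu$, $P_\theta$ the distribution with density $f(\cdot;\theta)$, $\mathcal R:\Theta\to\mathbb R$ a regularization function and $\sigma>0$. Write $\mathcal L(\theta;x)=-\log f(x;\theta)+\mathcal R(\theta)$ and $\mathcal L(\theta;x,w)=\mathcal L(\theta;x)+\sigma w^\top\theta$. Let $\widehat\theta:\mathcal X\times\mathbb R^d\to\Theta$ be measurable. A point $\theta$ is a strict second-order stationary point (SSOSP) of $\mathcal L(\cdot;x,w)$ if $\nabla_\theta\mathcal L(\theta;x,w)=0$ and $\nabla_\theta^2\mathcal L(\theta;x,w)\succ0$. Let $r:\Theta\to(0,\infty)$ and $\delta,\varepsilon:\Theta\to\mathbb R$. Assume: 1. (Regularity) $\Theta$ is convex and open; $f(x;\theta)>0$ for all $x\in\mathcal X$, $\theta\in\Theta$; $\mathcal R$ is twice differentiable; and $\theta\mapsto\mathcal L(\theta;x)$ is twice continuously differentiable on $\Theta$ for every $x$. 2. For every $\theta_0\in\Theta$, if $(X,W)\sim P_{\theta_0}\times\mathcal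 N(0,\frac1d\mathbf I_d)$, then with probability at least $1-\delta(\theta_0)$ both $\|\widehat\theta(X,W)-\theta_0\|\le r(\theta_0)$ and $\widehat\theta(X,W)$ is a SSOSP of $\mathcal L(\cdot;X,W)$. 3. For every $\theta_0\in\Theta$, with $H(\theta;x)=-\nabla_\theta^2\log f(x;\theta)$ and $\mathbb B$ denoting closed Euclidean balls, the expectation $H(\theta)=\mathbb E_{\theta_0}[H(\theta;X)]$ exists for all $\theta\in\mathbb B(\theta_0,r(\theta_0))\cap\Theta$, and $$\mathbb E_{\theta_0}\Big[\sup_{\theta\in\mathbb B(\theta_0,r(\theta_0))\cap\Theta} r(\theta_0)^2\big(\lambda_{\max}(H(\theta)-H(\theta;X))\big)_+\Big]\le\varepsilon(\theta_0),$$ $$\mathbb E_{\theta_0}\Big[\exp\Big\{\sup_{\theta\in\mathbb B(\theta_0,r(\theta_0))\cap\Theta} r(\theta_0)^2\big(\lambda_{\max}(H(\theta;X)-H(\theta))\big)_+\Big\}\Big]\le e^{\varepsilon(\theta_0)}.$$ Let $\mathcal X_\theta$ be the set of $x\in\mathcal X$ such that, for some $w\in\mathbb R^d$, $\theta=\widehat\theta(x,w)$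 is a SSOSP of $\mathcal L(\cdot;x,w)$, and let $p_\theta(\cdot\mid\theta)$ be the probability density with respect to $\nu$ proportional to $$f(x;\theta)\,\exp\Big\{-\frac{\|\nabla_\theta\mathcal L(\theta;x)\|^2}{2\sigma^2/d}\Big\}\,\det\big(\nabla_\theta^2\mathcal L(\theta;x)\big)\,\mathbf 1\{x\in\mathcal X_\theta\}.$$ Let $M\ge0$ be an integer and let $\widetilde P_M(\cdot;x,\theta)$ be a probability kernel on $\mathcal X^M$ such that, for every $\theta\in\Theta$ with $\nu(\mathcal X_\theta)>0$: if $X\sim p_\theta(\cdot\mid\theta)$ and $(\widetilde X^{(1)},\dots,\widetilde X^{(M)})\mid X\sim\widetilde P_M(\cdot;X,\theta)$, then $(X,\widetilde X^{(1)},\dots,\widetilde X^{(M)})$ is exchangeable. Let $X\sim P_{\theta_0}$ for some $\theta_0\in\Theta$, and generate the aCSS copies as follows: draw $W\sim\mathcal N(0,\frac1d\mathbf I_d)$ independently of $X$; if $\widehat\theta=\widehat\theta(X,W)$ is a SSOSP of $\mathcal L(\cdot;X,W)$, draw $(\widetilde X^{(1)},\dots,\widetilde X^{(M)})\sim\widetilde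 P_M(\cdot;X,\widehat\theta)$; otherwise set $\widetilde X^{(1)}=\dots=\widetilde X^{(M)}=X$. Then $$\mathsf d_{\mathsf{exch}}(X,\widetilde X^{(1)},\dots,\widetilde X^{(M)})\le 3\sigma\,r(\theta_0)+\delta(\theta_0)+\varepsilon(\theta_0),$$ where $\mathsf d_{\mathsf{exch}}$ is the infimum of the total variation distance $\sup_A|P(A)-Q(A)|$ between the joint law $P$ of the given random variables and an exchangeable law $Q$. Consequently, for every measurable test statistic $T:\mathcal X\to\mathbb R$ and every $\alpha\in[0,1]$, the p-value $\mathrm{pval}=\frac1{M+1}\big(1+\sum_{m=1}^M\mathbf 1\{T(\widetilde X^{(m)})\ge T(X)\}\big)$ satisfies $$\mathbb P(\mathrm{pval}\le\alpha)\le\alpha+3\sigma\,r(\theta_0)+\delta(\theta_0)+\varepsilon(\theta_0).$$ -/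

import Mathlib

open MeasureTheory ProbabilityTheory
open scoped ENNReal Gradient

noncomputable section

/-! ### Derivatives on `ℝ^d`, strict second-order stationary points -/

/-- The Hessian matrix `(∂ᵢ∂ⱼ g (θ))ᵢⱼ` of `g : ℝ^d → ℝ` at `θ`. -/
def hessian {d : ℕ} (g : EuclideanSpace ℝ (Fin d) → ℝ) (θ : EuclideanSpace ℝ (Fin d)) :
    Matrix (Fin d) (Fin d) ℝ :=
  Matrix.of fun i j =>
    fderiv ℝ (fderiv ℝ g) θ (EuclideanSpace.single i 1) (EuclideanSpace.single j 1)

/-- `θ` is a strict second-order stationary point (SSOSP) of `g`: the gradient vanishes and the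
Hessian is positive definite. -/
def IsSSOSP {d : ℕ} (g : EuclideanSpace ℝ (Fin d) → ℝ) (θ : EuclideanSpace ℝ (Fin d)) : Prop :=
  ∇ g θ = 0 ∧ (hessian g θ).PosDef

/-- The largest eigenvalue of a (symmetric) real matrix. -/
def lambdaMax {d : ℕ} (A : Matrix (Fin d) (Fin d) ℝ) : ℝ :=
  sSup {l : ℝ | Module.End.HasEigenvalue (Matrix.toLin' A) l}

/-! ### Total variation, exchangeability, p-values -/

/-- Total variation distance `sup_A |μ(A) - ν(A)|` over measurable sets. -/
def tvDist {S : Type*} [MeasurableSpace S] (μ ν : Measure S) : ℝ :=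
  ⨆ A : {A : Set S // MeasurableSet A}, |μ.real A.1 - ν.real A.1|

/-- A law of `k` random variables is exchangeable: it is invariant under permutations of the
coordinates. -/
def IsExchangeable {k : ℕ} {S : Type*} [MeasurableSpace S] (μ : Measure (Fin k → S)) : Prop :=
  ∀ π : Equiv.Perm (Fin k), μ.map (fun b i => b (π i)) = μ

/-- Distance to exchangeability of random variables `A₁, …, A_k` on `(Ω, Pr)`: the infimum of the
total variation distance between their joint law and an exchangeable joint law. -/
def dExch {k : ℕ} {S Ω : Type*} [MeasurableSpace S] [MeasurableSpace Ω]
    (Pr : Measure Ω) (A : Fin k → Ω → S) : ℝ :=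
  sInf {t : ℝ | ∃ Q : Measure (Fin k → S), IsProbabilityMeasure Q ∧ IsExchangeable Q ∧
    t = tvDist (Pr.map fun ω i => A i ω) Q}

open Classical in
/-- The p-value `(1 + #{m : T(x̃ₘ) ≥ T(x)}) / (M + 1)`. -/
def pval {M : ℕ} {S : Type*} (T : S → ℝ) (x : S) (xt : Fin M → S) : ℝ :=
  1 / ((M : ℝ) + 1) * (1 + ∑ m : Fin M, if T x ≤ T (xt m) then (1 : ℝ) else 0)

/-! ### The model, the perturbed loss and the aCSS procedure

Throughout, `f θ x` is the density at `x` of `P_θ` with respect to the base measure `ν`, `R` is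
the regularization function, `σ` the noise level and `θhat x w` the perturbed estimator. -/

/-- The distribution `P_θ` with density `f(·;θ)` with respect to `ν`. -/
def modelLaw {d : ℕ} {S : Type*} [MeasurableSpace S] (ν : Measure S)
    (f : EuclideanSpace ℝ (Fin d) → S → ℝ) (θ : EuclideanSpace ℝ (Fin d)) : Measure S :=
  ν.withDensity fun x => ENNReal.ofReal (f θ x)

/-- The noise distribution `N(0, d⁻¹ I_d)`. -/
def noiseLaw (d : ℕ) : Measure (EuclideanSpace ℝ (Fin d)) :=
  multivariateGaussian 0 ((1 / (d : ℝ)) • (1 : Matrix (Fin d) (Fin d) ℝ))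

/-- `𝓛(θ;x) = -log f(x;θ) + R(θ)`. -/
def loss {d : ℕ} {S : Type*} (f : EuclideanSpace ℝ (Fin d) → S → ℝ)
    (R : EuclideanSpace ℝ (Fin d) → ℝ) (x : S) (θ : EuclideanSpace ℝ (Fin d)) : ℝ :=
  -Real.log (f θ x) + R θ

/-- `𝓛(θ;x,w) = 𝓛(θ;x) + σ wᵀθ`. -/
def perturbedLoss {d : ℕ} {S : Type*} (f : EuclideanSpace ℝ (Fin d) → S → ℝ)
    (R : EuclideanSpace ℝ (Fin d) → ℝ) (σ : ℝ) (x : S) (w θ : EuclideanSpace ℝ (Fin d)) : ℝ :=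
  loss f R x θ + σ * inner ℝ w θ

/-- `𝓧_θ`: the set of `x` such that, for some `w`, `θ = θhat(x,w)` is a SSOSP of `𝓛(·;x,w)`. -/
def supportSet {d : ℕ} {S : Type*} (f : EuclideanSpace ℝ (Fin d) → S → ℝ)
    (R : EuclideanSpace ℝ (Fin d) → ℝ) (σ : ℝ)
    (θhat : S → EuclideanSpace ℝ (Fin d) → EuclideanSpace ℝ (Fin d))
    (θ : EuclideanSpace ℝ (Fin d)) : Set S :=
  {x | ∃ w, θ = θhat x w ∧ IsSSOSP (perturbedLoss f R σ x w) θ}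

/-- The unnormalized density of `p_θ(· | θ)`:
`f(x;θ) · exp{-‖∇𝓛(θ;x)‖² / (2σ²/d)} · det(∇²𝓛(θ;x)) · 1{x ∈ 𝓧_θ}`. -/
def unnormDensity {d : ℕ} {S : Type*} (f : EuclideanSpace ℝ (Fin d) → S → ℝ)
    (R : EuclideanSpace ℝ (Fin d) → ℝ) (σ : ℝ)
    (θhat : S → EuclideanSpace ℝ (Fin d) → EuclideanSpace ℝ (Fin d))
    (θ : EuclideanSpace ℝ (Fin d)) : S → ℝ :=
  (supportSet f R σ θhat θ).indicator fun x =>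
    f θ x * Real.exp (-(‖∇ (loss f R x) θ‖ ^ 2 / (2 * σ ^ 2 / d))) * (hessian (loss f R x) θ).det

/-- The law on the data space whose density with respect to `ν` is `p_θ(· | θ)`, i.e. proportional
to `unnormDensity`. -/
def plugInLaw {d : ℕ} {S : Type*} [MeasurableSpace S] (ν : Measure S)
    (f : EuclideanSpace ℝ (Fin d) → S → ℝ) (R : EuclideanSpace ℝ (Fin d) → ℝ) (σ : ℝ)
    (θhat : S → EuclideanSpace ℝ (Fin d) → EuclideanSpace ℝ (Fin d))
    (θ : EuclideanSpace ℝ (Fin d)) : Measure S :=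
  (∫⁻ x, ENNReal.ofReal (unnormDensity f R σ θhat θ x) ∂ν)⁻¹ •
    ν.withDensity fun x => ENNReal.ofReal (unnormDensity f R σ θhat θ x)

/-- The condition on the mechanism `Pt = P̃_M(· ; x, θ)` for drawing the copies: for all `θ ∈ Θ`
with `ν(𝓧_θ) > 0`, if `X ∼ p_θ(· | θ)` and `(X̃⁽¹⁾, …, X̃⁽ᴹ⁾) | X ∼ P̃_M(· ; X, θ)`, then
`(X, X̃⁽¹⁾, …, X̃⁽ᴹ⁾)` is exchangeable. -/
def SamplerExchangeable {d M : ℕ} {S : Type*} [MeasurableSpace S]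
    (Θ : Set (EuclideanSpace ℝ (Fin d))) (ν : Measure S)
    (f : EuclideanSpace ℝ (Fin d) → S → ℝ) (R : EuclideanSpace ℝ (Fin d) → ℝ) (σ : ℝ)
    (θhat : S → EuclideanSpace ℝ (Fin d) → EuclideanSpace ℝ (Fin d))
    (Pt : Kernel (S × EuclideanSpace ℝ (Fin d)) (Fin M → S)) : Prop :=
  ∀ θ ∈ Θ, 0 < ν (supportSet f R σ θhat θ) →
    IsExchangeable
      ((plugInLaw ν f R σ θhat θ ⊗ₘ Pt.comap (fun x => (x, θ)) measurable_prodMk_right).map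
        fun p : S × (Fin M → S) => (Fin.cons p.1 p.2 : Fin (M + 1) → S))

open Classical in
/-- Conditional law of the aCSS copies given the data `x` and the noise `w`: `P̃_M(· ; x, θhat(x,w))`
if `θhat(x,w)` is a SSOSP of `𝓛(·;x,w)`, and otherwise all copies are equal to `x`. -/
def copiesLaw {d M : ℕ} {S : Type*} [MeasurableSpace S]
    (f : EuclideanSpace ℝ (Fin d) → S → ℝ) (R : EuclideanSpace ℝ (Fin d) → ℝ) (σ : ℝ)
    (θhat : S → EuclideanSpace ℝ (Fin d) → EuclideanSpace ℝ (Fin d))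
    (Pt : Kernel (S × EuclideanSpace ℝ (Fin d)) (Fin M → S))
    (x : S) (w : EuclideanSpace ℝ (Fin d)) : Measure (Fin M → S) :=
  if IsSSOSP (perturbedLoss f R σ x w) (θhat x w) then Pt (x, θhat x w)
  else Measure.dirac fun _ => x

/-- The random variables `X`, `W`, `X̃⁽¹⁾, …, X̃⁽ᴹ⁾` on `(Ω, Pr)` are a run of the aCSS algorithm on
data from `P_{θ₀}`: `X ∼ P_{θ₀}`, `W ∼ N(0, d⁻¹ I_d)` is independent of `X`, and given `(X, W)` the
copies are drawn from `copiesLaw`. -/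
structure IsACSSRun {d M : ℕ} {S Ω : Type*} [MeasurableSpace S] [MeasurableSpace Ω]
    (ν : Measure S) (f : EuclideanSpace ℝ (Fin d) → S → ℝ) (R : EuclideanSpace ℝ (Fin d) → ℝ)
    (σ : ℝ) (θhat : S → EuclideanSpace ℝ (Fin d) → EuclideanSpace ℝ (Fin d))
    (Pt : Kernel (S × EuclideanSpace ℝ (Fin d)) (Fin M → S)) (θ₀ : EuclideanSpace ℝ (Fin d))
    (Pr : Measure Ω) (X : Ω → S) (W : Ω → EuclideanSpace ℝ (Fin d))
    (Xt : Fin M → Ω → S) : Prop where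
  measurable_data : Measurable X
  measurable_noise : Measurable W
  measurable_copies : ∀ m, Measurable (Xt m)
  law_data_noise : Pr.map (fun ω => (X ω, W ω)) = (modelLaw ν f θ₀).prod (noiseLaw d)
  law_copies : ∀ A : Set ((S × EuclideanSpace ℝ (Fin d)) × (Fin M → S)), MeasurableSet A →
    Pr {ω | ((X ω, W ω), fun m => Xt m ω) ∈ A} =
      ∫⁻ p, copiesLaw f R σ θhat Pt p.1 p.2 {y | (p, y) ∈ A}
        ∂((modelLaw ν f θ₀).prod (noiseLaw d))

/-! ### The assumptions -/

/-- Regularity conditions on the parametric family and the regularization function. -/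
structure RegularityConditions {d : ℕ} {S : Type*} [MeasurableSpace S]
    (Θ : Set (EuclideanSpace ℝ (Fin d))) (ν : Measure S)
    (f : EuclideanSpace ℝ (Fin d) → S → ℝ) (R : EuclideanSpace ℝ (Fin d) → ℝ) : Prop where
  isOpen : IsOpen Θ
  convex : Convex ℝ Θ
  measurable_density : ∀ θ ∈ Θ, Measurable (f θ)
  density_pos : ∀ θ ∈ Θ, ∀ x, 0 < f θ x
  isProbabilityMeasure : ∀ θ ∈ Θ, IsProbabilityMeasure (modelLaw ν f θ)
  /-- `R` is twice differentiable on `Θ` -/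
  differentiable_reg : DifferentiableOn ℝ R Θ
  differentiable_fderiv_reg : DifferentiableOn ℝ (fderiv ℝ R) Θ
  /-- `𝓛(·;x)` is twice continuously differentiable on `Θ` -/
  contDiff_loss : ∀ x, ContDiffOn ℝ 2 (loss f R x) Θ

/-- With probability at least `1 - δ(θ₀)` over `(X,W) ∼ P_{θ₀} × N(0, d⁻¹ I_d)`, the estimator is
within `r(θ₀)` of `θ₀` and is a SSOSP of `𝓛(·;X,W)`. -/
def EstimatorAccurate {d : ℕ} {S : Type*} [MeasurableSpace S]
    (Θ : Set (EuclideanSpace ℝ (Fin d))) (ν : Measure S)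
    (f : EuclideanSpace ℝ (Fin d) → S → ℝ) (R : EuclideanSpace ℝ (Fin d) → ℝ) (σ : ℝ)
    (θhat : S → EuclideanSpace ℝ (Fin d) → EuclideanSpace ℝ (Fin d))
    (r δ : EuclideanSpace ℝ (Fin d) → ℝ) : Prop :=
  ∀ θ₀ ∈ Θ, 1 - δ θ₀ ≤ ((modelLaw ν f θ₀).prod (noiseLaw d)).real
    {p | ‖θhat p.1 p.2 - θ₀‖ ≤ r θ₀ ∧ IsSSOSP (perturbedLoss f R σ p.1 p.2) (θhat p.1 p.2)}

/-- `H(θ;x) = -∇²_θ log f(x;θ)`. -/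
def obsInfo {d : ℕ} {S : Type*} (f : EuclideanSpace ℝ (Fin d) → S → ℝ)
    (θ : EuclideanSpace ℝ (Fin d)) (x : S) : Matrix (Fin d) (Fin d) ℝ :=
  -hessian (fun t => Real.log (f t x)) θ

/-- `H(θ) = 𝔼_{θ₀}[H(θ;X)]` (entrywise expectation). -/
def meanInfo {d : ℕ} {S : Type*} [MeasurableSpace S] (ν : Measure S)
    (f : EuclideanSpace ℝ (Fin d) → S → ℝ) (θ₀ θ : EuclideanSpace ℝ (Fin d)) :
    Matrix (Fin d) (Fin d) ℝ :=
  Matrix.of fun i j => ∫ x, obsInfo f θ x i j ∂(modelLaw ν f θ₀)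

/-- `sup_{θ ∈ 𝔹(θ₀,ρ) ∩ Θ} ρ² (λ_max(A(θ)))₊`, as an extended nonnegative number. -/
def supLambdaMax {d : ℕ} (Θ : Set (EuclideanSpace ℝ (Fin d))) (θ₀ : EuclideanSpace ℝ (Fin d))
    (ρ : ℝ) (A : EuclideanSpace ℝ (Fin d) → Matrix (Fin d) (Fin d) ℝ) : ℝ≥0∞ :=
  ⨆ θ ∈ Metric.closedBall θ₀ ρ ∩ Θ, ENNReal.ofReal (ρ ^ 2 * max (lambdaMax (A θ)) 0)

/-- The Hessian concentration conditions at `θ₀` with radius `ρ` and bound `e`. The two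
measurability fields say that the expectations in the two bounds are meaningful. -/
structure HessianConcentrationAt {d : ℕ} {S : Type*} [MeasurableSpace S]
    (Θ : Set (EuclideanSpace ℝ (Fin d))) (ν : Measure S)
    (f : EuclideanSpace ℝ (Fin d) → S → ℝ) (θ₀ : EuclideanSpace ℝ (Fin d)) (ρ e : ℝ) : Prop where
  integrable : ∀ θ ∈ Metric.closedBall θ₀ ρ ∩ Θ, ∀ i j,
    Integrable (fun x => obsInfo f θ x i j) (modelLaw ν f θ₀)
  aemeasurable_lower : AEMeasurable
    (fun x => supLambdaMax Θ θ₀ ρ fun θ => meanInfo ν f θ₀ θ - obsInfo f θ x) (modelLaw ν f θ₀)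
  aemeasurable_upper : AEMeasurable
    (fun x => supLambdaMax Θ θ₀ ρ fun θ => obsInfo f θ x - meanInfo ν f θ₀ θ) (modelLaw ν f θ₀)
  lower : ∫⁻ x, supLambdaMax Θ θ₀ ρ (fun θ => meanInfo ν f θ₀ θ - obsInfo f θ x)
    ∂(modelLaw ν f θ₀) ≤ ENNReal.ofReal e
  upper : ∫⁻ x, EReal.exp
      ((supLambdaMax Θ θ₀ ρ fun θ => obsInfo f θ x - meanInfo ν f θ₀ θ : ℝ≥0∞) : EReal)
    ∂(modelLaw ν f θ₀) ≤ ENNReal.ofReal (Real.exp e)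

end

/-!
# Approximate exchangeability of the aCSS copies

If the estimator `θhat x w` is a strict second-order stationary point `θ` of `𝓛(·;x,w)`, the
gradient condition forces `w = -σ⁻¹ ∇𝓛(θ;x)` (`impliedNoise`). For fixed `x`, noise and estimator
thus determine each other, with Jacobian `σ⁻ᵈ det ∇²𝓛(θ;x)`, and the Gaussian density of the noise
turns into a joint density of data and estimator: up to a constant, `f(x;θ₀) · u(θ,x)` with
`u = selectionWeight` (`lintegral_isSSOSP_eq`, `lintegral_prod_isSSOSP_eq`). Given the estimator,
the data have density proportional to `f(·;θ₀) u(θ,·)`, while the sampler makes the copies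
exchangeable with data of density `p_θ(· | θ) ∝ f(·;θ) u(θ,·)`. Replacing the former by the latter,
on the event that the estimator is a SSOSP within `ρ = r θ₀` of `θ₀`, and keeping the law of the
estimator gives an exchangeable measure (`plugInMixture`, `isExchangeable_plugInMixture`). Constant
vectors complete it to an exchangeable probability measure `Q`. It remains to show that the law
of `(X, copies)` is at most `Q + 3σρ + δ + ε` on every event.

The complement of the event costs `δ`. On the event one compares the two densities. For two data
points `x, x'` the second-order Taylor remainders of `𝓛(·;x)` and `𝓛(·;x')` between `θ` and `θ₀`
differ by at most half of `D⁺(x) + D⁻(x')`, where `D⁺`, `D⁻` are the suprema in the Hessian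
concentration condition, because the mean Hessian cancels (`taylor_remainder_sub_le`). As the first
order term is `-σ wᵀ(θ₀ - θ)` with `w` the implied noise, the likelihood ratio `f(x;θ) / f(x;θ₀)` is
a constant depending on `θ` times a factor between `exp(-V)` and `exp U`, where
`U = σρ‖w‖ + D⁺(x)/2` and `V = σρ‖w‖ + D⁻(x)/2` (`exists_likelihoodRatio_bounds`). From `1 - z ≤ -log z`
and the tangent bound `log t ≤ log κ + t/κ - 1` the mass lost for a given `θ` is at most the integral
of `log κ + exp U / κ - 1 + V` (`lintegral_one_sub_tilt_le`). In terms of data and noise this is an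
integral of a function of the independent pair `(X, W)`, so it only remains to bound
`log 𝔼 exp U + 𝔼 V` (`lintegral_tiltBound_le`). The Gaussian integral
`𝔼 exp(s‖W‖) ≤ exp(5s/4)` for `0 ≤ s ≤ 1/3` (`lintegral_exp_norm_noiseLaw_le`) and the concentration
condition bound it by `5σρ/2 + ε`. If `σρ > 1/3` the claim is trivial.

The p-value bound follows because the p-value is superuniform under an exchangeable law
(`IsExchangeable.measureReal_pval_le`).
-/

/-! ### Largest eigenvalues, positive definiteness and Hessians -/

lemma dotProduct_mulVec_le_lambdaMax {d : ℕ} {A : Matrix (Fin d) (Fin d) ℝ} (hA : A.IsHermitian)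
    (v : Fin d → ℝ) : v ⬝ᵥ A.mulVec v ≤ lambdaMax A * (v ⬝ᵥ v) := by
  have hB : (lambdaMax A • (1 : Matrix (Fin d) (Fin d) ℝ) - A).IsHermitian := by
    refine Matrix.IsHermitian.sub ?_ hA
    simp [Matrix.IsHermitian]
  have hpsd : (lambdaMax A • (1 : Matrix (Fin d) (Fin d) ℝ) - A).PosSemidef := by
    rw [hB.posSemidef_iff_eigenvalues_nonneg]
    intro j
    have hj := hB.mulVec_eigenvectorBasis j
    set w : Fin d → ℝ := (hB.eigenvectorBasis j).ofLp with hw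
    have hw0 : w ≠ 0 := by
      intro h0
      have h1 : hB.eigenvectorBasis j = 0 := by
        ext i
        exact congrFun h0 i
      exact hB.eigenvectorBasis.toBasis.ne_zero j (by simpa using h1)
    -- an eigenvector of `λ - A` for `μ` is an eigenvector of `A` for `λ - μ`
    have hAw : A.mulVec w = (lambdaMax A - hB.eigenvalues j) • w := by
      rw [Matrix.sub_mulVec, Matrix.smul_mulVec, Matrix.one_mulVec] at hj
      rw [sub_smul, ← hj]
      abel
    have heig : Module.End.HasEigenvalue (Matrix.toLin' A) (lambdaMax A - hB.eigenvalues j) := by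
      apply Module.End.hasEigenvalue_of_hasEigenvector (x := w)
      rw [Module.End.hasEigenvector_iff]
      refine ⟨?_, hw0⟩
      rw [Module.End.mem_eigenspace_iff, Matrix.toLin'_apply, hAw]
    have hle : lambdaMax A - hB.eigenvalues j ≤ lambdaMax A :=
      le_csSup (Module.End.finite_hasEigenvalue (Matrix.toLin' A)).bddAbove heig
    simp only [Pi.zero_apply]
    linarith
  have h := (Matrix.posSemidef_iff_dotProduct_mulVec.1 hpsd).2 v
  simp only [star_trivial, Matrix.sub_mulVec, Matrix.smul_mulVec, Matrix.one_mulVec,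
    dotProduct_sub, dotProduct_smul, smul_eq_mul] at h
  linarith

lemma measurableSet_posDef (d : ℕ) :
    MeasurableSet {a : Fin d → Fin d → ℝ | (Matrix.of a).PosDef} := by
  have h : {a : Fin d → Fin d → ℝ | (Matrix.of a).PosDef} =
      {a | (Matrix.of a).IsHermitian} ∩
        (⋂ v : Fin d → ℝ, {a | 0 ≤ v ⬝ᵥ (Matrix.of a).mulVec v}) ∩
        {a | (Matrix.of a).det ≠ 0} := by
    ext a
    simp only [Set.mem_ofPred_eq, Set.mem_inter_iff, Set.mem_iInter]
    constructor
    · intro h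
      have := h.posSemidef
      exact ⟨⟨h.isHermitian, fun v => by
        simpa using (Matrix.posSemidef_iff_dotProduct_mulVec.1 this).2 v⟩,
        this.posDef_iff_det_ne_zero.1 h⟩
    · rintro ⟨⟨h1, h2⟩, h3⟩
      exact (Matrix.PosSemidef.posDef_iff_det_ne_zero
        (Matrix.posSemidef_iff_dotProduct_mulVec.2 ⟨h1, fun v => by simpa using h2 v⟩)).2 h3
  rw [h]
  refine (IsClosed.measurableSet ?_).inter (IsOpen.measurableSet ?_)
  · refine IsClosed.inter ?_ (isClosed_iInter fun v => isClosed_le continuous_const ?_)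
    · exact isClosed_eq (f := fun a : Fin d → Fin d → ℝ => (Matrix.of a).conjTranspose)
        (g := fun a => Matrix.of a)
        (Continuous.matrix_conjTranspose continuous_id) continuous_id
    · exact Continuous.dotProduct continuous_const
        (Continuous.matrix_mulVec continuous_id continuous_const)
  · exact isOpen_ne_fun (f := fun a : Fin d → Fin d → ℝ => (Matrix.of a).det)
      (Continuous.matrix_det continuous_id) continuous_const

section Hessian

variable {d : ℕ}

lemma fderiv_fderiv_apply_self (g : EuclideanSpace ℝ (Fin d) → ℝ)
    (θ v : EuclideanSpace ℝ (Fin d)) :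
    fderiv ℝ (fderiv ℝ g) θ v v = v.ofLp ⬝ᵥ (hessian g θ).mulVec v.ofLp := by
  have hv : v = ∑ i, v i • EuclideanSpace.single i (1 : ℝ) := by
    simpa using ((EuclideanSpace.basisFun (Fin d) ℝ).sum_repr v).symm
  conv_lhs => rw [hv]
  simp only [map_sum, map_smul, sum_apply, smul_apply,
    smul_eq_mul, dotProduct, Matrix.mulVec, hessian, Matrix.of_apply]
  rw [Finset.sum_congr rfl fun i _ => Finset.mul_sum _ _ _, Finset.sum_comm]
  refine Finset.sum_congr rfl fun i _ => ?_
  rw [Finset.mul_sum]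
  refine Finset.sum_congr rfl fun j _ => ?_
  ring

lemma isHermitian_hessian {g : EuclideanSpace ℝ (Fin d) → ℝ} {θ : EuclideanSpace ℝ (Fin d)}
    (h1 : ∀ᶠ t in nhds θ, DifferentiableAt ℝ g t) (h2 : DifferentiableAt ℝ (fderiv ℝ g) θ) :
    (hessian g θ).IsHermitian := by
  ext i j
  simp only [hessian, Matrix.conjTranspose_apply, Matrix.of_apply, star_trivial]
  exact second_derivative_symmetric_of_eventually (h1.mono fun t ht => ht.hasFDerivAt)
    h2.hasFDerivAt _ _

lemma hessian_sub {g h : EuclideanSpace ℝ (Fin d) → ℝ} {θ : EuclideanSpace ℝ (Fin d)}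
    (g1 : ∀ᶠ t in nhds θ, DifferentiableAt ℝ g t) (g2 : DifferentiableAt ℝ (fderiv ℝ g) θ)
    (h1 : ∀ᶠ t in nhds θ, DifferentiableAt ℝ h t) (h2 : DifferentiableAt ℝ (fderiv ℝ h) θ) :
    hessian (fun t => g t - h t) θ = hessian g θ - hessian h θ := by
  have he : fderiv ℝ (fun t => g t - h t) =ᶠ[nhds θ] fun t => fderiv ℝ g t - fderiv ℝ h t := by
    filter_upwards [g1, h1] with t ht1 ht2
    exact fderiv_fun_sub ht1 ht2
  ext i j
  simp only [hessian, Matrix.of_apply, Matrix.sub_apply]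
  rw [he.fderiv_eq, fderiv_fun_sub g2 h2]
  rfl

/-- Second order Taylor bound along the segment from `a` to `a + v`, from an upper bound on the
second derivative in the direction `v`. -/
lemma taylor_le_of_second_deriv_le {E : Type*} [NormedAddCommGroup E] [NormedSpace ℝ E]
    {g : E → ℝ} {a v : E} {B : ℝ}
    (h1 : ∀ t ∈ Set.Icc (0 : ℝ) 1, DifferentiableAt ℝ g (a + t • v))
    (h2 : ∀ t ∈ Set.Icc (0 : ℝ) 1, DifferentiableAt ℝ (fderiv ℝ g) (a + t • v))
    (hB : ∀ t ∈ Set.Icc (0 : ℝ) 1, fderiv ℝ (fderiv ℝ g) (a + t • v) v v ≤ B) :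
    g (a + v) - g a - fderiv ℝ g a v ≤ B / 2 := by
  have hline : ∀ t : ℝ, HasDerivAt (fun t : ℝ => a + t • v) v t := fun t => by
    simpa using ((hasDerivAt_id t).smul_const v).const_add a
  have hd1 : ∀ t ∈ Set.Icc (0 : ℝ) 1,
      HasDerivAt (fun t : ℝ => g (a + t • v)) (fderiv ℝ g (a + t • v) v) t := fun t ht =>
    (h1 t ht).hasFDerivAt.comp_hasDerivAt t (hline t)
  have hd2 : ∀ t ∈ Set.Icc (0 : ℝ) 1,
      HasDerivAt (fun t : ℝ => fderiv ℝ g (a + t • v) v)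
        (fderiv ℝ (fderiv ℝ g) (a + t • v) v v) t := fun t ht => by
    exact (ContinuousLinearMap.apply ℝ ℝ v).hasFDerivAt.comp_hasDerivAt t
      ((h2 t ht).hasFDerivAt.comp_hasDerivAt t (hline t))
  have anti : ∀ (p p' : ℝ → ℝ), (∀ t ∈ Set.Icc (0 : ℝ) 1, HasDerivAt p (p' t) t) →
      (∀ t ∈ Set.Icc (0 : ℝ) 1, p' t ≤ 0) → AntitoneOn p (Set.Icc 0 1) := by
    intro p p' hp hp'
    refine antitoneOn_of_deriv_nonpos (convex_Icc 0 1)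
      (fun t ht => (hp t ht).continuousAt.continuousWithinAt)
      (fun t ht => (hp t (interior_subset ht)).differentiableAt.differentiableWithinAt)
      fun t ht => ?_
    rw [(hp t (interior_subset ht)).deriv]
    exact hp' t (interior_subset ht)
  have A1 := anti (fun t => fderiv ℝ g (a + t • v) v - B * t) _
    (fun t ht => (hd2 t ht).sub ((hasDerivAt_id t).const_mul B)) (fun t ht => by
      have := hB t ht
      simp only [mul_one]
      linarith)
  have hslope : ∀ t ∈ Set.Icc (0 : ℝ) 1, fderiv ℝ g (a + t • v) v ≤ fderiv ℝ g a v + B * t := by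
    intro t ht
    have := A1 (Set.left_mem_Icc.2 zero_le_one) ht ht.1
    simp only [zero_smul, add_zero, mul_zero, sub_zero] at this
    linarith
  have A2 := anti (fun t => g (a + t • v) - fderiv ℝ g a v * t - B / 2 * t ^ 2) _
    (fun t ht => ((hd1 t ht).sub ((hasDerivAt_id t).const_mul _)).sub
      ((hasDerivAt_pow 2 t).const_mul (B / 2))) (fun t ht => by
      have := hslope t ht
      simp only [mul_one, Nat.cast_ofNat, Nat.add_one_sub_one, pow_one]
      linarith)
  have := A2 (Set.left_mem_Icc.2 zero_le_one) (Set.right_mem_Icc.2 zero_le_one) zero_le_one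
  simp only [one_smul, zero_smul, add_zero, mul_zero, sub_zero, mul_one, one_pow,
    ne_eq, OfNat.ofNat_ne_zero, not_false_eq_true, zero_pow] at this
  linarith

end Hessian

/-! ### Measurability of functions of the data and the parameter -/

section Measurability

variable {d : ℕ} {S : Type*} [MeasurableSpace S]

/-- A Carathéodory function on `S × Θ`, extended by zero, is jointly measurable. -/
lemma measurable_indicator_of_continuousOn {E : Type*} [TopologicalSpace E]
    [TopologicalSpace.MetrizableSpace E]
    [MeasurableSpace E] [SecondCountableTopology E] [OpensMeasurableSpace E]
    {Θ : Set E} (hΘ : MeasurableSet Θ) {F : E → S → ℝ} (hF : ∀ θ ∈ Θ, Measurable (F θ))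
    (hc : ∀ x, ContinuousOn (fun θ => F θ x) Θ) :
    Measurable fun p : S × E => Θ.indicator (fun θ => F θ p.1) p.2 := by
  have h0 : StronglyMeasurable (Function.uncurry fun (θ : Θ) (x : S) => F θ x) :=
    stronglyMeasurable_uncurry_of_continuous_of_stronglyMeasurable
      (fun x => continuousOn_iff_continuous_domRestrict.1 (hc x))
      fun θ => (hF θ θ.2).stronglyMeasurable
  have hemb : MeasurableEmbedding (Prod.map id Subtype.val : S × Θ → S × E) :=
    MeasurableEmbedding.id.prodMap (MeasurableEmbedding.subtype_coe hΘ)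
  have h1 : Measurable (fun q : S × Θ => F q.2 q.1) := h0.measurable.comp measurable_swap
  have h2 := hemb.measurable_extend h1 (measurable_const (a := (0 : ℝ)))
  convert h2 using 1
  funext p
  by_cases hp : p.2 ∈ Θ
  · have : p = Prod.map id Subtype.val ((p.1, ⟨p.2, hp⟩) : S × Θ) := rfl
    rw [Set.indicator_of_mem hp]
    conv_rhs => rw [this, hemb.injective.extend_apply]
  · rw [Set.indicator_of_notMem hp, Function.extend_apply']
    rintro ⟨q, rfl⟩
    exact hp q.2.2

/-- Derivatives in the parameter of a family of measurable functions are measurable. -/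
lemma measurable_fderiv_param {E : Type*} [NormedAddCommGroup E] [NormedSpace ℝ E]
    {Θ : Set E} (hΘ : IsOpen Θ) {F : E → S → ℝ} (hF : ∀ θ ∈ Θ, Measurable (F θ))
    {θ : E} (hθ : θ ∈ Θ) (hd : ∀ x, DifferentiableAt ℝ (fun t => F t x) θ) (v : E) :
    Measurable fun x => fderiv ℝ (fun t => F t x) θ v := by
  have hline : HasDerivAt (fun t : ℝ => θ + t • v) v 0 := by
    simpa using ((hasDerivAt_id (0 : ℝ)).smul_const v).const_add θ
  have hnear : ∀ᶠ t : ℝ in nhds 0, θ + t • v ∈ Θ :=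
    hline.continuousAt.eventually_mem (by simpa using hΘ.mem_nhds hθ)
  have hseq : Filter.Tendsto (fun n : ℕ => 1 / ((n : ℝ) + 1)) Filter.atTop (nhds 0) :=
    tendsto_one_div_add_atTop_nhds_zero_nat
  obtain ⟨N, hN⟩ := Filter.eventually_atTop.1 (hseq.eventually hnear)
  set t : ℕ → ℝ := fun n => 1 / (((n + N : ℕ) : ℝ) + 1) with ht
  have ht0 : Filter.Tendsto t Filter.atTop (nhds 0) :=
    hseq.comp (Filter.tendsto_add_atTop_nat N)
  have htne : ∀ n, t n ≠ 0 := fun n => by positivity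
  refine measurable_of_tendsto_metrizable
    (f := fun n x => (t n)⁻¹ • (F (θ + t n • v) x - F θ x)) (fun n => ?_) ?_
  · exact ((hF _ (hN (n + N) (by omega))).sub (hF θ hθ)).const_mul (t n)⁻¹
  · rw [tendsto_pi_nhds]
    intro x
    have hdx : HasFDerivAt (fun t => F t x) (fderiv ℝ (fun t => F t x) θ) (θ + (0 : ℝ) • v) := by
      simpa using (hd x).hasFDerivAt
    have hd0 := hdx.comp_hasDerivAt (0 : ℝ) hline
    rw [hasDerivAt_iff_tendsto_slope_zero] at hd0
    have := hd0.comp (tendsto_nhdsWithin_iff.2 ⟨ht0, Filter.Eventually.of_forall htne⟩)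
    simpa [Function.comp_def] using this

end Measurability

/-! ### The Gaussian noise -/

section Noise

variable {d : ℕ}

/-- The normalizing constant of the density of `N(0, d⁻¹ I_d)`. -/
noncomputable def noiseConst (d : ℕ) : ℝ :=
  (∫ w : EuclideanSpace ℝ (Fin d), Real.exp (-((d : ℝ) / 2) * ‖w‖ ^ 2))⁻¹

lemma integral_exp_neg_mul_sq_norm_pos {b : ℝ} (hb : 0 < b) :
    0 < ∫ w : EuclideanSpace ℝ (Fin d), Real.exp (-b * ‖w‖ ^ 2) := by
  rw [GaussianFourier.integral_rexp_neg_mul_sq_norm hb]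
  positivity

lemma noiseConst_pos (hd : 0 < d) : 0 < noiseConst d :=
  inv_pos.2 (integral_exp_neg_mul_sq_norm_pos (by positivity))

lemma lintegral_exp_neg_mul_sq_norm {b : ℝ} (hb : 0 < b) :
    ∫⁻ w : EuclideanSpace ℝ (Fin d), ENNReal.ofReal (Real.exp (-b * ‖w‖ ^ 2)) =
      ENNReal.ofReal (∫ w : EuclideanSpace ℝ (Fin d), Real.exp (-b * ‖w‖ ^ 2)) := by
  rw [ofReal_integral_eq_lintegral_ofReal]
  · by_contra h
    exact (integral_exp_neg_mul_sq_norm_pos (d := d) hb).ne' (integral_undef h)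
  · exact Filter.Eventually.of_forall fun w => (Real.exp_pos _).le

lemma noiseLaw_eq_withDensity (hd : 0 < d) :
    noiseLaw d = volume.withDensity fun w : EuclideanSpace ℝ (Fin d) =>
      ENNReal.ofReal (noiseConst d * Real.exp (-((d : ℝ) / 2) * ‖w‖ ^ 2)) := by
  have hb : (0 : ℝ) < (d : ℝ) / 2 := by positivity
  have hC := noiseConst_pos hd
  have hmeas : Measurable fun w : EuclideanSpace ℝ (Fin d) =>
      ENNReal.ofReal (noiseConst d * Real.exp (-((d : ℝ) / 2) * ‖w‖ ^ 2)) := by fun_prop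
  have hfin : IsFiniteMeasure (volume.withDensity fun w : EuclideanSpace ℝ (Fin d) =>
      ENNReal.ofReal (noiseConst d * Real.exp (-((d : ℝ) / 2) * ‖w‖ ^ 2))) := by
    refine isFiniteMeasure_withDensity ?_
    simp_rw [ENNReal.ofReal_mul hC.le]
    rw [lintegral_const_mul _ (by fun_prop), lintegral_exp_neg_mul_sq_norm hb]
    exact ENNReal.mul_ne_top ENNReal.ofReal_ne_top ENNReal.ofReal_ne_top
  have hfin' : IsFiniteMeasure (noiseLaw d) := by
    unfold noiseLaw
    infer_instance
  apply Measure.ext_of_charFun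
  funext t
  have hpsd : ((1 / (d : ℝ)) • (1 : Matrix (Fin d) (Fin d) ℝ)).PosSemidef :=
    Matrix.PosSemidef.one.smul (by positivity)
  have hb' : 0 < (((d : ℝ) / 2 : ℝ) : ℂ).re := by simpa using hb
  have hre : (((∫ w : EuclideanSpace ℝ (Fin d), Real.exp (-((d : ℝ) / 2) * ‖w‖ ^ 2)) : ℝ) : ℂ) =
      ((Real.pi : ℂ) / (((d : ℝ) / 2 : ℝ) : ℂ)) ^
        ((Module.finrank ℝ (EuclideanSpace ℝ (Fin d)) : ℂ) / 2) := by
    rw [← integral_complex_ofReal]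
    have := GaussianFourier.integral_cexp_neg_mul_sq_norm_add hb' 0
      (0 : EuclideanSpace ℝ (Fin d))
    simp only [zero_mul, add_zero, norm_zero, inner_zero_left] at this
    simp only [Complex.ofReal_zero, ne_eq, OfNat.ofNat_ne_zero, not_false_eq_true, zero_pow,
      mul_zero, zero_div, Complex.exp_zero, mul_one] at this
    rw [← this]
    congr 1
    funext w
    push_cast
    rfl
  unfold noiseLaw
  rw [charFun_multivariateGaussian hpsd, charFun_apply,
    integral_withDensity_eq_integral_toReal_smul hmeas (by simp)]
  have hF := GaussianFourier.integral_cexp_neg_mul_sq_norm_add hb' Complex.I t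
  rw [← hre] at hF
  have hCne : (((∫ w : EuclideanSpace ℝ (Fin d), Real.exp (-((d : ℝ) / 2) * ‖w‖ ^ 2)) : ℝ) : ℂ) ≠ 0
    := by exact_mod_cast (integral_exp_neg_mul_sq_norm_pos hb).ne'
  calc _ = Complex.exp (Complex.I ^ 2 * (‖t‖ : ℂ) ^ 2 / (4 * (((d : ℝ) / 2 : ℝ) : ℂ))) := by
        congr 1
        have hn : t.ofLp ⬝ᵥ t.ofLp = ‖t‖ ^ 2 := by
          rw [EuclideanSpace.real_norm_sq_eq]
          simp [dotProduct, sq]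
        rw [Matrix.smul_mulVec, Matrix.one_mulVec, dotProduct_smul, hn]
        have : (d : ℂ) ≠ 0 := by exact_mod_cast hd.ne'
        simp only [inner_zero_right, Complex.ofReal_zero, zero_mul, smul_eq_mul, Complex.I_sq]
        push_cast
        field_simp
        ring
    _ = (noiseConst d : ℂ) *
        ∫ v, Complex.exp (-(((d : ℝ) / 2 : ℝ) : ℂ) * ‖v‖ ^ 2 + Complex.I * (inner ℝ t v : ℝ)) := by
        rw [hF, noiseConst, Complex.ofReal_inv, ← mul_assoc, inv_mul_cancel₀ hCne, one_mul]
    _ = _ := by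
        rw [← integral_const_mul]
        congr 1
        funext v
        rw [ENNReal.toReal_ofReal (by positivity), Complex.real_smul, Complex.ofReal_mul,
          Complex.ofReal_exp, mul_assoc, ← Complex.exp_add, real_inner_comm]
        congr 3
        · push_cast
          rfl
        · ring

lemma lintegral_exp_norm_noiseLaw_le (hd : 0 < d) {s : ℝ} (h0 : 0 ≤ s) (h1 : s ≤ 1 / 3) :
    ∫⁻ w, ENNReal.ofReal (Real.exp (s * ‖w‖)) ∂(noiseLaw d) ≤
      ENNReal.ofReal (Real.exp (5 / 4 * s)) := by
  have hC := noiseConst_pos hd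
  have hd1 : (1 : ℝ) ≤ d := by exact_mod_cast hd
  have hb : (0 : ℝ) < (d : ℝ) / 2 := by positivity
  have hb' : (0 : ℝ) < ((d : ℝ) - s) / 2 := by linarith
  rw [noiseLaw_eq_withDensity hd, lintegral_withDensity_eq_lintegral_mul _ (by fun_prop)
    (by fun_prop)]
  -- `s‖w‖ ≤ s/2 + (s/2)‖w‖²` reduces the claim to a Gaussian integral
  have hpt : ∀ w : EuclideanSpace ℝ (Fin d),
      ENNReal.ofReal (noiseConst d * Real.exp (-((d : ℝ) / 2) * ‖w‖ ^ 2)) *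
        ENNReal.ofReal (Real.exp (s * ‖w‖)) ≤
      ENNReal.ofReal (noiseConst d * Real.exp (s / 2)) *
        ENNReal.ofReal (Real.exp (-(((d : ℝ) - s) / 2) * ‖w‖ ^ 2)) := by
    intro w
    rw [← ENNReal.ofReal_mul (by positivity), ← ENNReal.ofReal_mul (by positivity)]
    apply ENNReal.ofReal_le_ofReal
    rw [mul_assoc, mul_assoc, ← Real.exp_add, ← Real.exp_add]
    refine mul_le_mul_of_nonneg_left (Real.exp_le_exp.2 ?_) hC.le
    nlinarith [mul_nonneg h0 (sq_nonneg (‖w‖ - 1))]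
  refine (lintegral_mono hpt).trans ?_
  rw [lintegral_const_mul _ (by fun_prop), lintegral_exp_neg_mul_sq_norm hb',
    ← ENNReal.ofReal_mul (by positivity)]
  apply ENNReal.ofReal_le_ofReal
  rw [noiseConst, GaussianFourier.integral_rexp_neg_mul_sq_norm hb',
    GaussianFourier.integral_rexp_neg_mul_sq_norm hb, finrank_euclideanSpace_fin]
  have hratio : Real.pi / (((d : ℝ) - s) / 2) ≤
      (Real.pi / ((d : ℝ) / 2)) * Real.exp (3 / 2 * s / d) := by
    have hds : (0 : ℝ) < (d : ℝ) - s := by linarith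
    have h2 : (d : ℝ) / (d - s) ≤ Real.exp (3 / 2 * s / d) := by
      refine le_trans ?_ (Real.add_one_le_exp _)
      rw [div_le_iff₀ hds]
      have : (3 / 2 * s / d + 1) * ((d : ℝ) - s) = d + s * (1 / 2 - 3 / 2 * s / d) := by
        field_simp
        ring
      rw [this]
      have h3 : 3 / 2 * s / d ≤ 1 / 2 := by
        rw [div_le_iff₀ (by positivity)]
        linarith
      nlinarith
    have h4 : Real.pi / (((d : ℝ) - s) / 2) = (Real.pi / ((d : ℝ) / 2)) * (d / (d - s)) := by
      field_simp
    rw [h4]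
    gcongr
  calc _ ≤ ((Real.pi / ((d : ℝ) / 2)) ^ ((d : ℝ) / 2))⁻¹ * Real.exp (s / 2) *
        ((Real.pi / ((d : ℝ) / 2)) * Real.exp (3 / 2 * s / d)) ^ ((d : ℝ) / 2) := by
        gcongr
    _ = Real.exp (s / 2) * Real.exp (3 / 2 * s / d * (d / 2)) := by
        rw [Real.mul_rpow (by positivity) (by positivity), ← Real.exp_mul]
        have : (Real.pi / ((d : ℝ) / 2)) ^ ((d : ℝ) / 2) ≠ 0 := by positivity
        field_simp
    _ = Real.exp (5 / 4 * s) := by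
        rw [← Real.exp_add]
        congr 1
        field_simp
        ring

end Noise

/-! ### Exponential tilts -/

/-- If the tilting factor `y` of the finite measure `m` lies between `exp (C - V)` and `exp (C + U)`,
then the tilt of `m` by `y`, rescaled to the mass of `m`, misses `m` by at most
`∫ (log κ + exp U / κ - 1 + V) dm`, for any `κ ≥ 1`. The constant `C` plays no role because of the
rescaling, and `κ` linearizes `log ∫ exp U dm`, so that the bound can be integrated over a family
of measures. -/
lemma lintegral_one_sub_tilt_le {S : Type*} [MeasurableSpace S] (m : Measure S)
    [IsFiniteMeasure m] {y U V : S → ℝ} (hy : Measurable y) (hU : Measurable U)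
    (hV : Measurable V) (hU0 : ∀ x, 0 ≤ U x) (hV0 : ∀ x, 0 ≤ V x) {C κ : ℝ} (hκ : 1 ≤ κ)
    (hlow : ∀ᵐ x ∂m, Real.exp (C - V x) ≤ y x) (hupp : ∀ᵐ x ∂m, y x ≤ Real.exp (C + U x)) :
    ∫⁻ x, (1 - m Set.univ / (∫⁻ z, ENNReal.ofReal (y z) ∂m) * ENNReal.ofReal (y x)) ∂m ≤
      ∫⁻ x, ENNReal.ofReal (Real.log κ + Real.exp (U x) / κ - 1 + V x) ∂m := by
  have hκ0 : 0 < κ := by linarith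
  have hlogκ : 0 ≤ Real.log κ := Real.log_nonneg hκ
  rcases eq_or_ne m 0 with rfl | hm
  · simp
  -- linearization of the logarithm at `κ`
  have hlin : ∀ t : ℝ, 0 < t → Real.log t ≤ Real.log κ + t / κ - 1 := by
    intro t ht
    have h := Real.log_le_sub_one_of_pos (div_pos ht hκ0)
    rw [Real.log_div ht.ne' hκ0.ne'] at h
    linarith
  have hW0 : ∀ x, 0 ≤ Real.log κ + Real.exp (U x) / κ - 1 := fun x => by
    have := hlin _ (Real.exp_pos (U x))
    rw [Real.log_exp] at this
    linarith [hU0 x]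
  by_cases hint : Integrable (fun x => Real.exp (U x)) m
  swap
  · have htop : ∫⁻ x, ENNReal.ofReal (Real.exp (U x)) ∂m = ∞ := by
      by_contra hne
      exact hint ((lintegral_ofReal_ne_top_iff_integrable (by fun_prop)
        (Filter.Eventually.of_forall fun x => (Real.exp_pos _).le)).1 hne)
    have hle : ∀ x, ENNReal.ofReal (Real.exp (U x)) ≤ ENNReal.ofReal κ *
        (ENNReal.ofReal (Real.log κ + Real.exp (U x) / κ - 1 + V x) + 1) := by
      intro x
      rw [← ENNReal.ofReal_one, ← ENNReal.ofReal_add (add_nonneg (hW0 x) (hV0 x)) zero_le_one,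
        ← ENNReal.ofReal_mul hκ0.le]
      apply ENNReal.ofReal_le_ofReal
      have h1 : Real.exp (U x) = κ * (Real.exp (U x) / κ) := by field_simp
      conv_lhs => rw [h1]
      gcongr
      linarith [hV0 x]
    have h2 := lintegral_mono (μ := m) hle
    rw [htop, lintegral_const_mul _ (by fun_prop), lintegral_add_right _ measurable_const,
      lintegral_one, top_le_iff] at h2
    have h3 : ∫⁻ x, ENNReal.ofReal (Real.log κ + Real.exp (U x) / κ - 1 + V x) ∂m = ∞ := by
      by_contra hne
      exact ENNReal.mul_ne_top ENNReal.ofReal_ne_top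
        (ENNReal.add_ne_top.2 ⟨hne, measure_ne_top m _⟩) h2
    rw [h3]
    exact le_top
  · have hy_pos : ∀ᵐ x ∂m, 0 < y x := hlow.mono fun x hx => (Real.exp_pos _).trans_le hx
    have hyint : Integrable y m := by
      refine Integrable.mono' (hint.const_mul (Real.exp C)) hy.aestronglyMeasurable ?_
      filter_upwards [hupp, hy_pos] with x hx hx0
      rw [Real.norm_of_nonneg hx0.le, ← Real.exp_add]
      exact hx
    set a : ℝ := m.real Set.univ with ha
    have ha0 : 0 < a := by
      rw [ha, measureReal_def]
      exact ENNReal.toReal_pos (by simpa using hm) (measure_ne_top m _)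
    set b : ℝ := ∫ x, y x ∂m with hb
    set e : ℝ := ∫ x, Real.exp (U x) ∂m with he
    -- `U ≥ 0`, so the tilt by `exp U` does not decrease mass
    have hae : a ≤ e := by
      have h1 : ∫ x, (1 : ℝ) ∂m ≤ e := by
        refine integral_mono (integrable_const _) hint fun x => ?_
        exact Real.one_le_exp (hU0 x)
      simpa using h1
    have he0 : 0 < e := ha0.trans_le hae
    have hb0 : 0 < b := by
      rw [hb, integral_pos_iff_support_of_nonneg_ae (hy_pos.mono fun x hx => hx.le) hyint]
      refine lt_of_lt_of_le (Measure.measure_univ_pos.2 hm) (measure_mono_ae ?_)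
      filter_upwards [hy_pos] with x hx _
      exact hx.ne'
    have hbe : b ≤ Real.exp C * e := by
      rw [hb, he, ← integral_const_mul]
      refine integral_mono_ae hyint (hint.const_mul _) ?_
      filter_upwards [hupp] with x hx
      rw [← Real.exp_add]
      exact hx
    set τ : ℝ := Real.log κ + (e / a) / κ - 1 with hτ
    have hτ0 : Real.log (e / a) ≤ τ := hlin _ (by positivity)
    have hτ1 : 0 ≤ τ := le_trans (Real.log_nonneg ((one_le_div ha0).2 hae)) hτ0
    have hbl : ∫⁻ z, ENNReal.ofReal (y z) ∂m = ENNReal.ofReal b := by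
      rw [hb, ofReal_integral_eq_lintegral_ofReal hyint (hy_pos.mono fun x hx => hx.le)]
    have hal : m Set.univ = ENNReal.ofReal a := by
      rw [ha, measureReal_def, ENNReal.ofReal_toReal (measure_ne_top m _)]
    have hpt : ∀ᵐ x ∂m, 1 - m Set.univ / (∫⁻ z, ENNReal.ofReal (y z) ∂m) * ENNReal.ofReal (y x) ≤
        ENNReal.ofReal τ + ENNReal.ofReal (V x) := by
      filter_upwards [hlow, hy_pos] with x hx hx0
      rw [hbl, hal, ← ENNReal.ofReal_div_of_pos hb0, ← ENNReal.ofReal_mul (by positivity),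
        ← ENNReal.ofReal_one, ← ENNReal.ofReal_sub _ (by positivity),
        ← ENNReal.ofReal_add hτ1 (hV0 x)]
      apply ENNReal.ofReal_le_ofReal
      -- `1 - z ≤ -log z`
      have h1 := Real.log_le_sub_one_of_pos (mul_pos (div_pos ha0 hb0) hx0)
      rw [Real.log_mul (by positivity) hx0.ne', Real.log_div ha0.ne' hb0.ne'] at h1
      have h2 : C - V x ≤ Real.log (y x) := by
        rw [← Real.log_exp (C - V x)]
        exact Real.log_le_log (Real.exp_pos _) hx
      have h3 : Real.log b ≤ C + Real.log e := by
        have := Real.log_le_log hb0 hbe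
        rwa [Real.log_mul (Real.exp_pos _).ne' (by linarith), Real.log_exp] at this
      rw [Real.log_div (by linarith) ha0.ne'] at hτ0
      linarith
    have hWint : Integrable (fun x => Real.log κ + Real.exp (U x) / κ - 1) m :=
      ((integrable_const _).add (hint.div_const κ)).sub (integrable_const _)
    calc _ ≤ ∫⁻ x, (ENNReal.ofReal τ + ENNReal.ofReal (V x)) ∂m := lintegral_mono_ae hpt
      _ = ENNReal.ofReal (∫ x, (Real.log κ + Real.exp (U x) / κ - 1) ∂m) +
          ∫⁻ x, ENNReal.ofReal (V x) ∂m := by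
          rw [lintegral_add_left measurable_const, lintegral_const, hal,
            ← ENNReal.ofReal_mul hτ1]
          congr 2
          have h1 : ∫ x, (Real.log κ + Real.exp (U x) / κ) ∂m = a * Real.log κ + e / κ := by
            rw [integral_add (integrable_const _) (hint.div_const κ), integral_const,
              integral_div, smul_eq_mul]
          have h2 : Integrable (fun x => Real.log κ + Real.exp (U x) / κ) m :=
            (integrable_const _).add (hint.div_const κ)
          rw [integral_sub h2 (integrable_const _), h1, integral_const, ← ha, hτ]
          simp only [smul_eq_mul]
          field_simp
      _ = ∫⁻ x, ENNReal.ofReal (Real.log κ + Real.exp (U x) / κ - 1 + V x) ∂m := by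
          rw [ofReal_integral_eq_lintegral_ofReal hWint (Filter.Eventually.of_forall hW0),
            ← lintegral_add_right _ (by fun_prop)]
          exact lintegral_congr fun x => (ENNReal.ofReal_add (hW0 x) (hV0 x)).symm

/-! ### Exchangeability and validity of the p-value -/

section Exchangeable

variable {S : Type*}

open Classical in
/-- The number of coordinates at which `T` is at least as large as at coordinate `k`. -/
noncomputable def rankCount {n : ℕ} (T : S → ℝ) (b : Fin n → S) (k : Fin n) : ℕ :=
  (Finset.univ.filter fun j => T (b k) ≤ T (b j)).card

open Classical in
lemma card_rankCount_le {n : ℕ} (T : S → ℝ) (b : Fin n → S) {c : ℝ} (hc : 0 ≤ c) :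
    ((Finset.univ.filter fun k => (rankCount T b k : ℝ) ≤ c).card : ℝ) ≤ c := by
  set K := Finset.univ.filter fun k => (rankCount T b k : ℝ) ≤ c with hK
  rcases K.eq_empty_or_nonempty with h | h
  · simpa [h] using hc
  · -- all members of `K` count towards the rank of the one with the smallest value
    obtain ⟨k, hkK, hk⟩ := K.exists_min_image (fun k => T (b k)) h
    have h1 : K.card ≤ rankCount T b k := by
      refine Finset.card_le_card fun j hj => ?_
      simpa using hk j hj
    have h2 : (rankCount T b k : ℝ) ≤ c := by
      have := (Finset.mem_filter.1 hkK).2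
      exact this
    exact le_trans (by exact_mod_cast h1) h2

lemma rankCount_comp_perm {n : ℕ} (T : S → ℝ) (b : Fin n → S) (π : Equiv.Perm (Fin n))
    (k : Fin n) : rankCount T (fun i => b (π i)) k = rankCount T b (π k) := by
  classical
  unfold rankCount
  refine Finset.card_bij (fun j _ => π j) ?_ ?_ ?_
  · intro j hj
    simpa using hj
  · intro i _ j _ h
    exact π.injective h
  · intro j hj
    exact ⟨π.symm j, by simpa using hj, by simp⟩

lemma pval_eq_rankCount {M : ℕ} (T : S → ℝ) (b : Fin (M + 1) → S) :
    pval T (b 0) (fun m => b m.succ) = (rankCount T b 0 : ℝ) / ((M : ℝ) + 1) := by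
  classical
  have : (rankCount T b 0 : ℝ) = ∑ j : Fin (M + 1), if T (b 0) ≤ T (b j) then (1 : ℝ) else 0 := by
    simp [rankCount]
  rw [this, Fin.sum_univ_succ, pval]
  simp only [le_refl, if_true]
  ring

variable [MeasurableSpace S]

lemma measurable_rankCount {n : ℕ} {T : S → ℝ} (hT : Measurable T) (k : Fin n) :
    Measurable fun b : Fin n → S => (rankCount T b k : ℝ) := by
  classical
  have : (fun b : Fin n → S => (rankCount T b k : ℝ)) =
      fun b => ∑ j : Fin n, if T (b k) ≤ T (b j) then (1 : ℝ) else 0 := by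
    funext b
    simp [rankCount]
  rw [this]
  refine Finset.measurable_sum _ fun j _ => Measurable.ite ?_ measurable_const measurable_const
  exact measurableSet_le (hT.comp (measurable_pi_apply k)) (hT.comp (measurable_pi_apply j))

/-- Under an exchangeable law the p-value is superuniform. -/
lemma IsExchangeable.measureReal_pval_le {M : ℕ} {Q : Measure (Fin (M + 1) → S)}
    [IsProbabilityMeasure Q] (hQ : IsExchangeable Q) {T : S → ℝ} (hT : Measurable T) {α : ℝ}
    (hα : 0 ≤ α) :
    Q.real {b | pval T (b 0) (fun m => b m.succ) ≤ α} ≤ α := by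
  classical
  have hM : (0 : ℝ) < (M : ℝ) + 1 := by positivity
  set c : ℝ := ((M : ℝ) + 1) * α with hc
  have hms : ∀ k : Fin (M + 1), MeasurableSet {b : Fin (M + 1) → S | (rankCount T b k : ℝ) ≤ c} :=
    fun k => measurableSet_le (measurable_rankCount hT k) measurable_const
  have hset : {b : Fin (M + 1) → S | pval T (b 0) (fun m => b m.succ) ≤ α} =
      {b | (rankCount T b 0 : ℝ) ≤ c} := by
    ext b
    rw [Set.mem_ofPred_eq, Set.mem_ofPred_eq, pval_eq_rankCount, div_le_iff₀' hM]
  rw [hset]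
  have hsame : ∀ k : Fin (M + 1), Q.real {b | (rankCount T b k : ℝ) ≤ c} =
      Q.real {b | (rankCount T b 0 : ℝ) ≤ c} := by
    intro k
    have h := hQ (Equiv.swap 0 k)
    conv_rhs => rw [← h]
    rw [map_measureReal_apply (by fun_prop) (hms 0)]
    congr 1
    ext b
    simp only [Set.mem_preimage, Set.mem_ofPred_eq]
    rw [rankCount_comp_perm, Equiv.swap_apply_left]
  have hsum : ∑ k : Fin (M + 1), Q.real {b | (rankCount T b k : ℝ) ≤ c} ≤ c := by
    have h1 : ∀ k : Fin (M + 1), Q.real {b | (rankCount T b k : ℝ) ≤ c} =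
        ∫ b, (if (rankCount T b k : ℝ) ≤ c then (1 : ℝ) else 0) ∂Q := by
      intro k
      rw [← integral_indicator_one (hms k)]
      congr 1
    have hi : ∀ k : Fin (M + 1),
        Integrable (fun b => if (rankCount T b k : ℝ) ≤ c then (1 : ℝ) else 0) Q := by
      intro k
      exact (integrable_const (1 : ℝ)).indicator (hms k)
    rw [Finset.sum_congr rfl fun k _ => h1 k, ← integral_finsetSum _ fun k _ => hi k]
    calc _ ≤ ∫ _, c ∂Q := by
          refine integral_mono (integrable_finsetSum _ fun k _ => hi k) (integrable_const _) ?_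
          intro b
          have := card_rankCount_le T b (c := c) (by positivity)
          simpa [Finset.sum_ite] using this
      _ = c := by simp
  rw [Finset.sum_congr rfl fun k _ => hsame k] at hsum
  simp only [Finset.sum_const, Finset.card_univ, Fintype.card_fin, nsmul_eq_mul] at hsum
  push_cast at hsum
  exact le_of_mul_le_mul_left hsum hM

lemma tvDist_le_of_forall_le {P Q : Measure S} [IsProbabilityMeasure P] [IsProbabilityMeasure Q]
    {t : ℝ} (h : ∀ A, MeasurableSet A → P.real A ≤ Q.real A + t) : tvDist P Q ≤ t := by
  have : Nonempty {A : Set S // MeasurableSet A} := ⟨⟨∅, MeasurableSet.empty⟩⟩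
  refine ciSup_le fun A => ?_
  have h1 := h A.1 A.2
  have h2 := h A.1ᶜ A.2.compl
  rw [probReal_compl_eq_one_sub A.2, probReal_compl_eq_one_sub A.2] at h2
  rw [abs_le]
  constructor <;> linarith

lemma dExch_le {k : ℕ} {Ω : Type*} [MeasurableSpace Ω] {Pr : Measure Ω} {A : Fin k → Ω → S}
    {Q : Measure (Fin k → S)} [IsProbabilityMeasure Q] (hQ : IsExchangeable Q) {t : ℝ}
    (h : tvDist (Pr.map fun ω i => A i ω) Q ≤ t) : dExch Pr A ≤ t := by
  refine le_trans (csInf_le ⟨0, ?_⟩ ⟨Q, inferInstance, hQ, rfl⟩) h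
  rintro _ ⟨Q', -, -, rfl⟩
  exact Real.iSup_nonneg fun A => abs_nonneg _

/-- The law of a constant vector is exchangeable. -/
lemma isExchangeable_map_const {k : ℕ} (P : Measure S) :
    IsExchangeable (P.map fun x (_ : Fin k) => x) := by
  intro π
  rw [Measure.map_map (by fun_prop) (by fun_prop)]
  rfl

lemma IsExchangeable.measure_preimage {k : ℕ} {Q : Measure (Fin k → S)} (hQ : IsExchangeable Q)
    (π : Equiv.Perm (Fin k)) {A : Set (Fin k → S)} (hA : MeasurableSet A) :
    Q ((fun b i => b (π i)) ⁻¹' A) = Q A := by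
  conv_rhs => rw [← hQ π]
  rw [Measure.map_apply (by fun_prop) hA]

end Exchangeable

/-! ### The perturbed loss and the change of variables from noise to parameter -/

section Model

variable {d : ℕ} {S : Type*}

/-- The only noise vector `w` for which `θ` can be a stationary point of `𝓛(·;x,w)`, namely
`-σ⁻¹ ∇𝓛(θ;x)`. -/
noncomputable def impliedNoise (f : EuclideanSpace ℝ (Fin d) → S → ℝ)
    (R : EuclideanSpace ℝ (Fin d) → ℝ) (σ : ℝ) (x : S) (θ : EuclideanSpace ℝ (Fin d)) :
    EuclideanSpace ℝ (Fin d) :=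
  -(σ⁻¹ • ∇ (loss f R x) θ)

/-- The factor by which `f(x;θ)` is multiplied in the unnormalized density of `p_θ(· | θ)`. Up to a
constant, `f(x;θ₀)` times this factor is the joint density of the data and the estimator on the
event that the estimator is a SSOSP. -/
noncomputable def selectionWeight (f : EuclideanSpace ℝ (Fin d) → S → ℝ)
    (R : EuclideanSpace ℝ (Fin d) → ℝ) (σ : ℝ)
    (θhat : S → EuclideanSpace ℝ (Fin d) → EuclideanSpace ℝ (Fin d))
    (θ : EuclideanSpace ℝ (Fin d)) : S → ℝ :=
  (supportSet f R σ θhat θ).indicator fun x =>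
    Real.exp (-(‖∇ (loss f R x) θ‖ ^ 2 / (2 * σ ^ 2 / d))) * (hessian (loss f R x) θ).det

lemma norm_impliedNoise_sq (f : EuclideanSpace ℝ (Fin d) → S → ℝ)
    (R : EuclideanSpace ℝ (Fin d) → ℝ) (σ : ℝ) (x : S) (θ : EuclideanSpace ℝ (Fin d)) :
    ((d : ℝ) / 2) * ‖impliedNoise f R σ x θ‖ ^ 2 =
      ‖∇ (loss f R x) θ‖ ^ 2 / (2 * σ ^ 2 / d) := by
  rw [impliedNoise, norm_neg, norm_smul, mul_pow, Real.norm_eq_abs, sq_abs, inv_pow,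
    div_div_eq_mul_div, mul_comm 2 (σ ^ 2), ← div_div, div_eq_mul_inv _ (σ ^ 2)]
  ring

lemma unnormDensity_eq_mul (f : EuclideanSpace ℝ (Fin d) → S → ℝ)
    (R : EuclideanSpace ℝ (Fin d) → ℝ) (σ : ℝ)
    (θhat : S → EuclideanSpace ℝ (Fin d) → EuclideanSpace ℝ (Fin d))
    (θ : EuclideanSpace ℝ (Fin d)) (x : S) :
    unnormDensity f R σ θhat θ x = f θ x * selectionWeight f R σ θhat θ x := by
  by_cases hx : x ∈ supportSet f R σ θhat θ
  · simp [unnormDensity, selectionWeight, hx, mul_assoc]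
  · simp [unnormDensity, selectionWeight, hx]

lemma gradient_eq_sum (g : EuclideanSpace ℝ (Fin d) → ℝ) (θ : EuclideanSpace ℝ (Fin d)) :
    ∇ g θ = ∑ i, fderiv ℝ g θ (EuclideanSpace.single i 1) • EuclideanSpace.single i (1 : ℝ) := by
  conv_lhs => rw [← (EuclideanSpace.basisFun (Fin d) ℝ).sum_repr' (∇ g θ)]
  refine Finset.sum_congr rfl fun i _ => ?_
  rw [EuclideanSpace.basisFun_apply, real_inner_comm, gradient,
    InnerProductSpace.toDual_symm_apply]

lemma inner_gradient (g : EuclideanSpace ℝ (Fin d) → ℝ) (θ v : EuclideanSpace ℝ (Fin d)) :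
    inner ℝ (∇ g θ) v = fderiv ℝ g θ v := by
  rw [gradient, InnerProductSpace.toDual_symm_apply]

lemma exists_hasFDerivAt_gradient {g : EuclideanSpace ℝ (Fin d) → ℝ}
    {θ : EuclideanSpace ℝ (Fin d)} (hg : DifferentiableAt ℝ (fderiv ℝ g) θ) :
    ∃ D : EuclideanSpace ℝ (Fin d) →L[ℝ] EuclideanSpace ℝ (Fin d),
      HasFDerivAt (∇ g) D θ ∧ D.det = (hessian g θ).det := by
  refine ⟨∑ i, ((ContinuousLinearMap.apply ℝ ℝ (EuclideanSpace.single i (1 : ℝ))).comp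
    (fderiv ℝ (fderiv ℝ g) θ)).smulRight (EuclideanSpace.single i (1 : ℝ)), ?_, ?_⟩
  · rw [show ∇ g = fun θ => ∑ i, fderiv ℝ g θ (EuclideanSpace.single i 1) •
      EuclideanSpace.single i (1 : ℝ) from funext fun θ => gradient_eq_sum g θ]
    refine HasFDerivAt.fun_sum fun i _ => HasFDerivAt.smul_const ?_ _
    exact (ContinuousLinearMap.apply ℝ ℝ (EuclideanSpace.single i (1 : ℝ))).hasFDerivAt.comp θ
      hg.hasFDerivAt
  · rw [ContinuousLinearMap.det,
      ← LinearMap.det_toMatrix (EuclideanSpace.basisFun (Fin d) ℝ).toBasis,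
      ← Matrix.det_transpose]
    congr 1
    ext i j
    rw [Matrix.transpose_apply, LinearMap.toMatrix_apply]
    simp [hessian]

lemma gradient_perturbedLoss {f : EuclideanSpace ℝ (Fin d) → S → ℝ}
    {R : EuclideanSpace ℝ (Fin d) → ℝ} (σ : ℝ) {x : S} (w : EuclideanSpace ℝ (Fin d))
    {θ : EuclideanSpace ℝ (Fin d)} (h : DifferentiableAt ℝ (loss f R x) θ) :
    ∇ (perturbedLoss f R σ x w) θ = ∇ (loss f R x) θ + σ • w := by
  refine ext_inner_right ℝ fun v => ?_
  have h1 : HasFDerivAt (perturbedLoss f R σ x w)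
      (fderiv ℝ (loss f R x) θ + σ • innerSL ℝ w) θ :=
    h.hasFDerivAt.add ((innerSL ℝ w).hasFDerivAt.const_mul σ)
  rw [inner_gradient, h1.fderiv, inner_add_left, inner_gradient, real_inner_smul_left]
  simp

lemma hessian_perturbedLoss {f : EuclideanSpace ℝ (Fin d) → S → ℝ}
    {R : EuclideanSpace ℝ (Fin d) → ℝ} (σ : ℝ) {x : S} (w : EuclideanSpace ℝ (Fin d))
    {θ : EuclideanSpace ℝ (Fin d)} (h : ∀ᶠ t in nhds θ, DifferentiableAt ℝ (loss f R x) t) :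
    hessian (perturbedLoss f R σ x w) θ = hessian (loss f R x) θ := by
  have he : fderiv ℝ (perturbedLoss f R σ x w) =ᶠ[nhds θ]
      fun t => fderiv ℝ (loss f R x) t + σ • innerSL ℝ w := by
    filter_upwards [h] with t ht
    have h1 : HasFDerivAt (perturbedLoss f R σ x w)
        (fderiv ℝ (loss f R x) t + σ • innerSL ℝ w) t :=
      ht.hasFDerivAt.add ((innerSL ℝ w).hasFDerivAt.const_mul σ)
    exact h1.fderiv
  ext i j
  simp only [hessian, Matrix.of_apply]
  rw [he.fderiv_eq, fderiv_add_const]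

variable [MeasurableSpace S] {Θ : Set (EuclideanSpace ℝ (Fin d))} {ν : Measure S}
  {f : EuclideanSpace ℝ (Fin d) → S → ℝ} {R : EuclideanSpace ℝ (Fin d) → ℝ} {σ : ℝ}
  {θhat : S → EuclideanSpace ℝ (Fin d) → EuclideanSpace ℝ (Fin d)}
  {θ : EuclideanSpace ℝ (Fin d)}

namespace RegularityConditions

lemma differentiableAt_loss (h : RegularityConditions Θ ν f R) (x : S) (hθ : θ ∈ Θ) :
    DifferentiableAt ℝ (loss f R x) θ :=
  ((h.contDiff_loss x).contDiffAt (h.isOpen.mem_nhds hθ)).differentiableAt (by norm_num)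

lemma eventually_differentiableAt_loss (h : RegularityConditions Θ ν f R) (x : S) (hθ : θ ∈ Θ) :
    ∀ᶠ t in nhds θ, DifferentiableAt ℝ (loss f R x) t := by
  filter_upwards [h.isOpen.mem_nhds hθ] with t ht using h.differentiableAt_loss x ht

lemma contDiffOn_fderiv_loss (h : RegularityConditions Θ ν f R) (x : S) :
    ContDiffOn ℝ 1 (fderiv ℝ (loss f R x)) Θ :=
  (h.contDiff_loss x).fderiv_of_isOpen h.isOpen (by norm_num)

lemma differentiableAt_fderiv_loss (h : RegularityConditions Θ ν f R) (x : S) (hθ : θ ∈ Θ) :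
    DifferentiableAt ℝ (fderiv ℝ (loss f R x)) θ :=
  ((h.contDiffOn_fderiv_loss x).contDiffAt (h.isOpen.mem_nhds hθ)).differentiableAt (by norm_num)

lemma isSSOSP_perturbedLoss_iff (h : RegularityConditions Θ ν f R) (hσ : 0 < σ) (x : S)
    (w : EuclideanSpace ℝ (Fin d)) (hθ : θ ∈ Θ) :
    IsSSOSP (perturbedLoss f R σ x w) θ ↔
      impliedNoise f R σ x θ = w ∧ (hessian (loss f R x) θ).PosDef := by
  rw [IsSSOSP, gradient_perturbedLoss σ w (h.differentiableAt_loss x hθ),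
    hessian_perturbedLoss σ w (h.eventually_differentiableAt_loss x hθ)]
  refine and_congr_left fun _ => ?_
  rw [impliedNoise, neg_eq_iff_eq_neg, inv_smul_eq_iff₀ hσ.ne', smul_neg, add_eq_zero_iff_eq_neg]

lemma mem_supportSet_iff (h : RegularityConditions Θ ν f R) (hσ : 0 < σ)
    (hmem : ∀ x w, θhat x w ∈ Θ) (x : S) :
    x ∈ supportSet f R σ θhat θ ↔ θ ∈ Θ ∧ θhat x (impliedNoise f R σ x θ) = θ ∧
      (hessian (loss f R x) θ).PosDef := by
  constructor
  · rintro ⟨w, hw, hs⟩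
    have hθ : θ ∈ Θ := hw ▸ hmem x w
    obtain ⟨h1, h2⟩ := (h.isSSOSP_perturbedLoss_iff hσ x w hθ).1 hs
    exact ⟨hθ, by rw [h1, hw], h2⟩
  · rintro ⟨hθ, h1, h2⟩
    exact ⟨_, h1.symm, (h.isSSOSP_perturbedLoss_iff hσ x _ hθ).2 ⟨rfl, h2⟩⟩

lemma measurable_loss (h : RegularityConditions Θ ν f R) (hθ : θ ∈ Θ) :
    Measurable fun x => loss f R x θ :=
  ((h.measurable_density θ hθ).log.neg).add_const _

lemma measurable_fderiv_loss (h : RegularityConditions Θ ν f R) (hθ : θ ∈ Θ)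
    (v : EuclideanSpace ℝ (Fin d)) : Measurable fun x => fderiv ℝ (loss f R x) θ v :=
  measurable_fderiv_param (F := fun θ x => loss f R x θ) h.isOpen
    (fun _ ht => h.measurable_loss ht) hθ (fun x => h.differentiableAt_loss x hθ) v

lemma measurable_hessian_loss_apply (h : RegularityConditions Θ ν f R) (hθ : θ ∈ Θ)
    (i j : Fin d) : Measurable fun x => hessian (loss f R x) θ i j := by
  have hd : ∀ x, DifferentiableAt ℝ
      (fun t => fderiv ℝ (loss f R x) t (EuclideanSpace.single j (1 : ℝ))) θ := fun x =>
    (h.differentiableAt_fderiv_loss x hθ).clm_apply (differentiableAt_const _)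
  have h1 := measurable_fderiv_param
    (F := fun θ x => fderiv ℝ (loss f R x) θ (EuclideanSpace.single j (1 : ℝ))) h.isOpen
    (fun _ ht => h.measurable_fderiv_loss ht _) hθ hd (EuclideanSpace.single i (1 : ℝ))
  convert h1 using 2 with x
  have h2 : HasFDerivAt (fun t => fderiv ℝ (loss f R x) t (EuclideanSpace.single j (1 : ℝ)))
      ((ContinuousLinearMap.apply ℝ ℝ (EuclideanSpace.single j (1 : ℝ))).comp
        (fderiv ℝ (fderiv ℝ (loss f R x)) θ)) θ :=
    (ContinuousLinearMap.apply ℝ ℝ (EuclideanSpace.single j (1 : ℝ))).hasFDerivAt.comp θ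
      (h.differentiableAt_fderiv_loss x hθ).hasFDerivAt
  rw [h2.fderiv]
  rfl

lemma measurable_indicator_density (h : RegularityConditions Θ ν f R) :
    Measurable fun p : S × EuclideanSpace ℝ (Fin d) => Θ.indicator (fun θ => f θ p.1) p.2 := by
  refine measurable_indicator_of_continuousOn h.isOpen.measurableSet h.measurable_density
    fun x => ?_
  have h1 : ContinuousOn (fun θ => Real.exp (R θ - loss f R x θ)) Θ :=
    (h.differentiable_reg.continuousOn.sub (h.contDiff_loss x).continuousOn).rexp
  refine h1.congr fun θ hθ => ?_
  simp only [loss]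
  rw [show R θ - (-Real.log (f θ x) + R θ) = Real.log (f θ x) by ring,
    Real.exp_log (h.density_pos θ hθ x)]

lemma measurable_indicator_hessian (h : RegularityConditions Θ ν f R) :
    Measurable fun p : S × EuclideanSpace ℝ (Fin d) => fun i j =>
      Θ.indicator (fun θ => hessian (loss f R p.1) θ i j) p.2 := by
  refine measurable_pi_lambda _ fun i => measurable_pi_lambda _ fun j => ?_
  refine measurable_indicator_of_continuousOn (F := fun θ x => hessian (loss f R x) θ i j)
    h.isOpen.measurableSet (fun θ hθ => h.measurable_hessian_loss_apply hθ i j) fun x => ?_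
  have h1 : ContinuousOn (fderiv ℝ (fderiv ℝ (loss f R x))) Θ :=
    (h.contDiffOn_fderiv_loss x).continuousOn_fderiv_of_isOpen h.isOpen (by norm_num)
  exact (h1.clm_apply continuousOn_const).clm_apply continuousOn_const

lemma measurable_indicator_impliedNoise (h : RegularityConditions Θ ν f R) (σ : ℝ) :
    Measurable fun p : S × EuclideanSpace ℝ (Fin d) =>
      Θ.indicator (impliedNoise f R σ p.1) p.2 := by
  have h1 : ∀ i : Fin d, Measurable fun p : S × EuclideanSpace ℝ (Fin d) =>
      Θ.indicator (fun θ => fderiv ℝ (loss f R p.1) θ (EuclideanSpace.single i (1 : ℝ))) p.2 :=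
    fun i => measurable_indicator_of_continuousOn
      (F := fun θ x => fderiv ℝ (loss f R x) θ (EuclideanSpace.single i (1 : ℝ)))
      h.isOpen.measurableSet (fun θ hθ => h.measurable_fderiv_loss hθ _)
      fun x => (h.contDiffOn_fderiv_loss x).continuousOn.clm_apply continuousOn_const
  have h2 : Measurable fun p : S × EuclideanSpace ℝ (Fin d) => -(σ⁻¹ • ∑ i,
      (Θ.indicator (fun θ => fderiv ℝ (loss f R p.1) θ (EuclideanSpace.single i (1 : ℝ))) p.2) •
        EuclideanSpace.single i (1 : ℝ)) :=
    ((Finset.measurable_sum _ fun i _ => (h1 i).smul_const _).const_smul σ⁻¹).neg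
  convert h2 using 2 with p
  by_cases hp : p.2 ∈ Θ
  · simp only [Set.indicator_of_mem hp]
    rw [impliedNoise, gradient_eq_sum]
  · simp only [Set.indicator_of_notMem hp]
    simp

lemma measurableSet_supportSet (h : RegularityConditions Θ ν f R) (hσ : 0 < σ)
    (hmeas : Measurable (Function.uncurry θhat)) (hmem : ∀ x w, θhat x w ∈ Θ) :
    MeasurableSet {p : S × EuclideanSpace ℝ (Fin d) | p.1 ∈ supportSet f R σ θhat p.2} := by
  have he : {p : S × EuclideanSpace ℝ (Fin d) | p.1 ∈ supportSet f R σ θhat p.2} =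
      (Prod.snd ⁻¹' Θ) ∩
        {p | Function.uncurry θhat (p.1, Θ.indicator (impliedNoise f R σ p.1) p.2) = p.2} ∩
        (fun (p : S × EuclideanSpace ℝ (Fin d)) i j =>
          Θ.indicator (fun θ => hessian (loss f R p.1) θ i j) p.2) ⁻¹'
          {a | (Matrix.of a).PosDef} := by
    ext p
    simp only [Set.mem_ofPred_eq, Set.mem_inter_iff, Set.mem_preimage, and_assoc,
      Function.uncurry_apply_pair]
    rw [h.mem_supportSet_iff hσ hmem]
    refine and_congr_right fun hp => ?_
    simp only [Set.indicator_of_mem hp]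
    rfl
  rw [he]
  refine ((measurable_snd h.isOpen.measurableSet).inter ?_).inter
    (h.measurable_indicator_hessian (measurableSet_posDef d))
  exact measurableSet_eq_fun
    (hmeas.comp (measurable_fst.prodMk (h.measurable_indicator_impliedNoise σ))) measurable_snd

lemma measurableSet_isSSOSP (h : RegularityConditions Θ ν f R) (hσ : 0 < σ)
    (hmeas : Measurable (Function.uncurry θhat)) (hmem : ∀ x w, θhat x w ∈ Θ) :
    MeasurableSet {p : S × EuclideanSpace ℝ (Fin d) |
      IsSSOSP (perturbedLoss f R σ p.1 p.2) (θhat p.1 p.2)} := by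
  have hm : Measurable fun p : S × EuclideanSpace ℝ (Fin d) => (p.1, θhat p.1 p.2) :=
    measurable_fst.prodMk hmeas
  have he : {p : S × EuclideanSpace ℝ (Fin d) |
      IsSSOSP (perturbedLoss f R σ p.1 p.2) (θhat p.1 p.2)} =
      {p | Θ.indicator (impliedNoise f R σ p.1) (θhat p.1 p.2) = p.2} ∩
        (fun p => (p.1, θhat p.1 p.2)) ⁻¹' ((fun (p : S × EuclideanSpace ℝ (Fin d)) i j =>
          Θ.indicator (fun θ => hessian (loss f R p.1) θ i j) p.2) ⁻¹'
          {a | (Matrix.of a).PosDef}) := by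
    ext p
    simp only [Set.mem_ofPred_eq, Set.mem_inter_iff, Set.mem_preimage]
    rw [h.isSSOSP_perturbedLoss_iff hσ _ _ (hmem _ _)]
    simp only [Set.indicator_of_mem (hmem _ _)]
    rfl
  rw [he]
  exact (measurableSet_eq_fun ((h.measurable_indicator_impliedNoise σ).comp hm)
    measurable_snd).inter (hm (h.measurable_indicator_hessian (measurableSet_posDef d)))

lemma selectionWeight_eq_zero (h : RegularityConditions Θ ν f R) (hσ : 0 < σ)
    (hmem : ∀ x w, θhat x w ∈ Θ) (hθ : θ ∉ Θ) (x : S) :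
    selectionWeight f R σ θhat θ x = 0 :=
  Set.indicator_of_notMem (fun hx => hθ ((h.mem_supportSet_iff hσ hmem x).1 hx).1) _

lemma measurable_selectionWeight (h : RegularityConditions Θ ν f R) (hσ : 0 < σ)
    (hmeas : Measurable (Function.uncurry θhat)) (hmem : ∀ x w, θhat x w ∈ Θ) :
    Measurable fun p : S × EuclideanSpace ℝ (Fin d) =>
      selectionWeight f R σ θhat p.2 p.1 := by
  have hdc : Continuous fun a : Fin d → Fin d → ℝ => (Matrix.of a).det :=
    Continuous.matrix_det continuous_id
  have hdet : Measurable fun p : S × EuclideanSpace ℝ (Fin d) =>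
      (Matrix.of fun i j => Θ.indicator (fun θ => hessian (loss f R p.1) θ i j) p.2).det :=
    hdc.measurable.comp h.measurable_indicator_hessian
  have hexp : Measurable fun p : S × EuclideanSpace ℝ (Fin d) =>
      Real.exp (-(((d : ℝ) / 2) * ‖Θ.indicator (impliedNoise f R σ p.1) p.2‖ ^ 2)) :=
    ((((h.measurable_indicator_impliedNoise σ).norm.pow_const 2).const_mul _).neg).exp
  have := (hexp.mul hdet).indicator (h.measurableSet_supportSet hσ hmeas hmem)
  convert this using 1
  funext p
  by_cases hp : p.1 ∈ supportSet f R σ θhat p.2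
  · have hΘ : p.2 ∈ Θ := ((h.mem_supportSet_iff hσ hmem _).1 hp).1
    rw [selectionWeight, Set.indicator_of_mem hp,
      Set.indicator_of_mem (show p ∈ {p : S × EuclideanSpace ℝ (Fin d) |
        p.1 ∈ supportSet f R σ θhat p.2} from hp)]
    simp only [Set.indicator_of_mem hΘ, Pi.mul_apply]
    rw [norm_impliedNoise_sq]
    rfl
  · rw [selectionWeight, Set.indicator_of_notMem hp,
      Set.indicator_of_notMem (show p ∉ {p : S × EuclideanSpace ℝ (Fin d) |
        p.1 ∈ supportSet f R σ θhat p.2} from hp)]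

/-- Change of variables from the noise `w` to the estimator `θ = θhat x w`, on the event that the
estimator is a SSOSP: there `w = impliedNoise x θ`, whose Jacobian is `σ⁻ᵈ det ∇²𝓛(θ;x)`. -/
lemma lintegral_isSSOSP_eq (h : RegularityConditions Θ ν f R) (hd : 0 < d) (hσ : 0 < σ)
    (hmeas : Measurable (Function.uncurry θhat)) (hmem : ∀ x w, θhat x w ∈ Θ) (x : S)
    (F : EuclideanSpace ℝ (Fin d) → EuclideanSpace ℝ (Fin d) → ℝ≥0∞) :
    ∫⁻ w in {w | IsSSOSP (perturbedLoss f R σ x w) (θhat x w)},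
        ENNReal.ofReal (noiseConst d * Real.exp (-((d : ℝ) / 2) * ‖w‖ ^ 2)) * F w (θhat x w) =
      ∫⁻ θ, ENNReal.ofReal (noiseConst d * (σ⁻¹) ^ d) *
        (ENNReal.ofReal (selectionWeight f R σ θhat θ x) * F (impliedNoise f R σ x θ) θ) := by
  have hC := noiseConst_pos hd
  set s : Set (EuclideanSpace ℝ (Fin d)) := {θ | x ∈ supportSet f R σ θhat θ} with hs
  have hsm : MeasurableSet s :=
    measurable_prodMk_left (h.measurableSet_supportSet hσ hmeas hmem)
  have hmem_s : ∀ θ ∈ s, θ ∈ Θ ∧ θhat x (impliedNoise f R σ x θ) = θ ∧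
      (hessian (loss f R x) θ).PosDef := fun θ hθ => (h.mem_supportSet_iff hσ hmem x).1 hθ
  have himg : {w | IsSSOSP (perturbedLoss f R σ x w) (θhat x w)} =
      impliedNoise f R σ x '' s := by
    ext w
    constructor
    · intro hw
      have h1 := (h.isSSOSP_perturbedLoss_iff hσ x w (hmem x w)).1 hw
      exact ⟨θhat x w, ⟨w, rfl, hw⟩, h1.1⟩
    · rintro ⟨θ, hθ, rfl⟩
      obtain ⟨h0, h1, h2⟩ := hmem_s θ hθ
      simp only [Set.mem_ofPred_eq]
      rw [h1]
      exact (h.isSSOSP_perturbedLoss_iff hσ x _ h0).2 ⟨rfl, h2⟩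
  have hinj : Set.InjOn (impliedNoise f R σ x) s := fun a ha b hb hab => by
    rw [← (hmem_s a ha).2.1, ← (hmem_s b hb).2.1, hab]
  have hder : ∀ θ : EuclideanSpace ℝ (Fin d),
      ∃ D : EuclideanSpace ℝ (Fin d) →L[ℝ] EuclideanSpace ℝ (Fin d), θ ∈ s →
        HasFDerivWithinAt (impliedNoise f R σ x) D s θ ∧
          |D.det| = (σ⁻¹) ^ d * (hessian (loss f R x) θ).det := by
    intro θ
    by_cases hθ : θ ∈ s
    · obtain ⟨D, hD, hdet⟩ :=
        exists_hasFDerivAt_gradient (h.differentiableAt_fderiv_loss x (hmem_s θ hθ).1)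
      have hneg : impliedNoise f R σ x = fun θ => (-σ⁻¹) • ∇ (loss f R x) θ :=
        funext fun θ => (neg_smul _ _).symm
      refine ⟨(-σ⁻¹) • D, fun _ =>
        ⟨hneg ▸ (hD.const_smul (-σ⁻¹)).hasFDerivWithinAt, ?_⟩⟩
      have hpos := (hmem_s θ hθ).2.2.det_pos
      have h1 : ((-σ⁻¹) • D).det = (-σ⁻¹) ^ d * D.det := by
        rw [ContinuousLinearMap.det, ContinuousLinearMap.toLinearMap_smul,
          LinearMap.det_smul, finrank_euclideanSpace_fin]
      rw [h1, hdet, abs_mul, abs_pow, abs_neg, abs_of_pos (inv_pos.2 hσ), abs_of_pos hpos]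
    · exact ⟨0, fun h => absurd h hθ⟩
  choose D hD using hder
  rw [himg, lintegral_image_eq_lintegral_abs_det_fderiv_mul volume hsm
    (fun θ hθ => (hD θ hθ).1) hinj, ← lintegral_indicator hsm]
  refine lintegral_congr fun θ => ?_
  by_cases hθ : θ ∈ s
  · rw [Set.indicator_of_mem hθ, (hD θ hθ).2, (hmem_s θ hθ).2.1, ← mul_assoc, ← mul_assoc]
    congr 1
    have hpos := (hmem_s θ hθ).2.2.det_pos
    rw [← ENNReal.ofReal_mul (by positivity), ← ENNReal.ofReal_mul (by positivity),
      selectionWeight, Set.indicator_of_mem (show x ∈ supportSet f R σ θhat θ from hθ),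
      ← norm_impliedNoise_sq, neg_mul]
    congr 1
    ring
  · rw [Set.indicator_of_notMem hθ, selectionWeight,
      Set.indicator_of_notMem (show x ∉ supportSet f R σ θhat θ from hθ)]
    simp

end RegularityConditions

end Model

/-! ### Likelihood ratios under Hessian concentration -/

section LikelihoodRatio

variable {d : ℕ} {S : Type*} [MeasurableSpace S] {Θ : Set (EuclideanSpace ℝ (Fin d))}
  {ν : Measure S} {f : EuclideanSpace ℝ (Fin d) → S → ℝ} {R : EuclideanSpace ℝ (Fin d) → ℝ}
  {σ : ℝ} {θ₀ θ : EuclideanSpace ℝ (Fin d)} {ρ : ℝ}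

lemma le_of_supLambdaMax_le {A : EuclideanSpace ℝ (Fin d) → Matrix (Fin d) (Fin d) ℝ} {a : ℝ}
    (ha : 0 ≤ a) (hA : supLambdaMax Θ θ₀ ρ A ≤ ENNReal.ofReal a)
    (hθ : θ ∈ Metric.closedBall θ₀ ρ ∩ Θ) : ρ ^ 2 * max (lambdaMax (A θ)) 0 ≤ a := by
  have h1 : ENNReal.ofReal (ρ ^ 2 * max (lambdaMax (A θ)) 0) ≤ supLambdaMax Θ θ₀ ρ A :=
    le_iSup₂ (f := fun θ (_ : θ ∈ Metric.closedBall θ₀ ρ ∩ Θ) =>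
      ENNReal.ofReal (ρ ^ 2 * max (lambdaMax (A θ)) 0)) θ hθ
  exact (ENNReal.ofReal_le_ofReal_iff ha).1 (h1.trans hA)

lemma dotProduct_mulVec_le_of_supLambdaMax_le
    {A : EuclideanSpace ℝ (Fin d) → Matrix (Fin d) (Fin d) ℝ} {a : ℝ}
    (ha : 0 ≤ a) (hA : supLambdaMax Θ θ₀ ρ A ≤ ENNReal.ofReal a)
    (hθ : θ ∈ Metric.closedBall θ₀ ρ ∩ Θ) (hsymm : (A θ).IsHermitian)
    {v : EuclideanSpace ℝ (Fin d)} (hv : ‖v‖ ≤ ρ) :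
    v.ofLp ⬝ᵥ (A θ).mulVec v.ofLp ≤ a := by
  have hn : v.ofLp ⬝ᵥ v.ofLp = ‖v‖ ^ 2 := by
    rw [EuclideanSpace.real_norm_sq_eq]
    simp [dotProduct, sq]
  calc v.ofLp ⬝ᵥ (A θ).mulVec v.ofLp ≤ lambdaMax (A θ) * ‖v‖ ^ 2 :=
        hn ▸ dotProduct_mulVec_le_lambdaMax hsymm v.ofLp
    _ ≤ max (lambdaMax (A θ)) 0 * ρ ^ 2 := by
        gcongr
        exact le_max_left _ _
    _ ≤ a := by
        rw [mul_comm]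
        exact le_of_supLambdaMax_le ha hA hθ

namespace RegularityConditions

lemma obsInfo_eq (h : RegularityConditions Θ ν f R) (hθ : θ ∈ Θ) (x : S) :
    obsInfo f θ x = hessian (loss f R x) θ - hessian R θ := by
  have hΘ := h.isOpen.mem_nhds hθ
  have h1 : (fun t => Real.log (f t x)) = fun t => R t - loss f R x t := by
    funext t
    simp [loss]
  have hR1 : ∀ᶠ t in nhds θ, DifferentiableAt ℝ R t := by
    filter_upwards [hΘ] with t ht using h.differentiable_reg.differentiableAt (h.isOpen.mem_nhds ht)
  rw [obsInfo, h1, hessian_sub hR1 (h.differentiable_fderiv_reg.differentiableAt hΘ)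
    (h.eventually_differentiableAt_loss x hθ) (h.differentiableAt_fderiv_loss x hθ), neg_sub]

lemma isHermitian_obsInfo (h : RegularityConditions Θ ν f R) (hθ : θ ∈ Θ) (x : S) :
    (obsInfo f θ x).IsHermitian := by
  have hΘ := h.isOpen.mem_nhds hθ
  have hR1 : ∀ᶠ t in nhds θ, DifferentiableAt ℝ R t := by
    filter_upwards [hΘ] with t ht using h.differentiable_reg.differentiableAt (h.isOpen.mem_nhds ht)
  rw [h.obsInfo_eq hθ]
  exact (isHermitian_hessian (h.eventually_differentiableAt_loss x hθ)
    (h.differentiableAt_fderiv_loss x hθ)).sub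
    (isHermitian_hessian hR1 (h.differentiable_fderiv_reg.differentiableAt hΘ))

lemma isHermitian_meanInfo (h : RegularityConditions Θ ν f R) (hθ : θ ∈ Θ) :
    (meanInfo ν f θ₀ θ).IsHermitian := by
  ext i j
  simp only [meanInfo, Matrix.conjTranspose_apply, Matrix.of_apply, star_trivial]
  refine integral_congr_ae (Filter.Eventually.of_forall fun x => ?_)
  simpa using (h.isHermitian_obsInfo hθ x).apply i j

/-- The second order Taylor remainders of the losses of two data points differ by at most half
the sum of the Hessian deviations: the mean Hessian, common to both, cancels. -/
lemma taylor_remainder_sub_le (h : RegularityConditions Θ ν f R) (hθ₀ : θ₀ ∈ Θ)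
    (hθ : θ ∈ Metric.closedBall θ₀ ρ ∩ Θ) {x x' : S} {a b : ℝ} (ha : 0 ≤ a) (hb : 0 ≤ b)
    (hx : supLambdaMax Θ θ₀ ρ (fun θ => obsInfo f θ x - meanInfo ν f θ₀ θ) ≤ ENNReal.ofReal a)
    (hx' : supLambdaMax Θ θ₀ ρ (fun θ => meanInfo ν f θ₀ θ - obsInfo f θ x') ≤
      ENNReal.ofReal b) :
    (loss f R x θ₀ - loss f R x θ - fderiv ℝ (loss f R x) θ (θ₀ - θ)) -
      (loss f R x' θ₀ - loss f R x' θ - fderiv ℝ (loss f R x') θ (θ₀ - θ)) ≤ (a + b) / 2 := by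
  have hnorm : ‖θ₀ - θ‖ ≤ ρ := by
    rw [norm_sub_rev, ← dist_eq_norm]
    exact hθ.1
  have hseg : ∀ t ∈ Set.Icc (0 : ℝ) 1, θ + t • (θ₀ - θ) ∈ Metric.closedBall θ₀ ρ ∩ Θ := by
    intro t ht
    have hball : θ₀ ∈ Metric.closedBall θ₀ ρ :=
      Metric.mem_closedBall_self ((norm_nonneg _).trans hnorm)
    exact ((convex_closedBall θ₀ ρ).inter h.convex).add_smul_sub_mem hθ ⟨hball, hθ₀⟩ ht
  have hdiff : ∀ (z : S) (t : ℝ), t ∈ Set.Icc (0 : ℝ) 1 →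
      DifferentiableAt ℝ (loss f R z) (θ + t • (θ₀ - θ)) := fun z t ht =>
    h.differentiableAt_loss z (hseg t ht).2
  have hev : ∀ (z : S) (t : ℝ), t ∈ Set.Icc (0 : ℝ) 1 →
      ∀ᶠ u in nhds (θ + t • (θ₀ - θ)), DifferentiableAt ℝ (loss f R z) u := fun z t ht =>
    h.eventually_differentiableAt_loss z (hseg t ht).2
  have hd2 : ∀ (z : S) (t : ℝ), t ∈ Set.Icc (0 : ℝ) 1 →
      DifferentiableAt ℝ (fderiv ℝ (loss f R z)) (θ + t • (θ₀ - θ)) := fun z t ht =>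
    h.differentiableAt_fderiv_loss z (hseg t ht).2
  have key := taylor_le_of_second_deriv_le (g := fun t => loss f R x t - loss f R x' t)
    (a := θ) (v := θ₀ - θ) (B := a + b)
    (fun t ht => (hdiff x t ht).sub (hdiff x' t ht))
    (fun t ht => by
      have he : fderiv ℝ (fun t => loss f R x t - loss f R x' t) =ᶠ[nhds (θ + t • (θ₀ - θ))]
          fun t => fderiv ℝ (loss f R x) t - fderiv ℝ (loss f R x') t := by
        filter_upwards [hev x t ht, hev x' t ht] with u hu hu'
        exact fderiv_fun_sub hu hu'
      exact he.differentiableAt_iff.2 ((hd2 x t ht).sub (hd2 x' t ht)))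
    (fun t ht => by
      have hm := hseg t ht
      rw [fderiv_fderiv_apply_self, hessian_sub (hev x t ht) (hd2 x t ht) (hev x' t ht)
        (hd2 x' t ht)]
      have hsplit : hessian (loss f R x) (θ + t • (θ₀ - θ)) -
          hessian (loss f R x') (θ + t • (θ₀ - θ)) =
          (obsInfo f (θ + t • (θ₀ - θ)) x - meanInfo ν f θ₀ (θ + t • (θ₀ - θ))) +
          (meanInfo ν f θ₀ (θ + t • (θ₀ - θ)) - obsInfo f (θ + t • (θ₀ - θ)) x') := by
        rw [h.obsInfo_eq hm.2, h.obsInfo_eq hm.2]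
        abel
      rw [hsplit, Matrix.add_mulVec, dotProduct_add]
      exact add_le_add
        (dotProduct_mulVec_le_of_supLambdaMax_le ha hx hm
          ((h.isHermitian_obsInfo hm.2 x).sub (h.isHermitian_meanInfo hm.2)) hnorm)
        (dotProduct_mulVec_le_of_supLambdaMax_le hb hx' hm
          ((h.isHermitian_meanInfo hm.2).sub (h.isHermitian_obsInfo hm.2 x')) hnorm))
  have h0 : (0 : ℝ) ∈ Set.Icc (0 : ℝ) 1 := Set.left_mem_Icc.2 zero_le_one
  have hx0 := hdiff x 0 h0
  have hx0' := hdiff x' 0 h0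
  rw [zero_smul, add_zero] at hx0 hx0'
  rw [fderiv_fun_sub hx0 hx0', add_sub_cancel] at key
  simp only [sub_apply] at key
  linarith

/-- The likelihood ratio `f(x;θ) / f(x;θ₀)` is a constant depending on `θ`, up to factors which are
controlled by the implied noise (first order term) and the Hessian deviations (second order
term). -/
lemma exists_likelihoodRatio_bounds (h : RegularityConditions Θ ν f R) (hσ : 0 < σ)
    (hθ₀ : θ₀ ∈ Θ) (hθ : θ ∈ Metric.closedBall θ₀ ρ ∩ Θ) {S₀ : Set S} (hS₀ : S₀.Nonempty)
    {Dp Dm : S → ℝ} (hDp : ∀ x, 0 ≤ Dp x) (hDm : ∀ x, 0 ≤ Dm x)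
    (hup : ∀ x ∈ S₀, supLambdaMax Θ θ₀ ρ (fun θ => obsInfo f θ x - meanInfo ν f θ₀ θ) ≤
      ENNReal.ofReal (Dp x))
    (hlo : ∀ x ∈ S₀, supLambdaMax Θ θ₀ ρ (fun θ => meanInfo ν f θ₀ θ - obsInfo f θ x) ≤
      ENNReal.ofReal (Dm x)) :
    ∃ C : ℝ, ∀ x ∈ S₀,
      Real.exp (C - (σ * ρ * ‖impliedNoise f R σ x θ‖ + Dm x / 2)) ≤ f θ x / f θ₀ x ∧
      f θ x / f θ₀ x ≤ Real.exp (C + (σ * ρ * ‖impliedNoise f R σ x θ‖ + Dp x / 2)) := by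
  set G : S → ℝ := fun x =>
    loss f R x θ₀ - loss f R x θ - fderiv ℝ (loss f R x) θ (θ₀ - θ) with hG
  have hcmp : ∀ x ∈ S₀, ∀ x' ∈ S₀, G x - Dp x / 2 ≤ G x' + Dm x' / 2 := by
    intro x hx x' hx'
    have := h.taylor_remainder_sub_le hθ₀ hθ (hDp x) (hDm x') (hup x hx) (hlo x' hx')
    simp only [hG]
    linarith
  -- a constant separating the lower bounds `G - Dp/2` from the upper bounds `G + Dm/2`
  set c : ℝ := sSup ((fun x => G x - Dp x / 2) '' S₀) with hc
  obtain ⟨x₁, hx₁⟩ := hS₀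
  have hbdd : BddAbove ((fun x => G x - Dp x / 2) '' S₀) :=
    ⟨G x₁ + Dm x₁ / 2, by rintro _ ⟨x, hx, rfl⟩; exact hcmp x hx x₁ hx₁⟩
  refine ⟨c + (R θ - R θ₀), fun x hx => ?_⟩
  have hlow : G x - Dp x / 2 ≤ c := le_csSup hbdd ⟨x, hx, rfl⟩
  have hupp : c ≤ G x + Dm x / 2 := by
    refine csSup_le ⟨_, x₁, hx₁, rfl⟩ ?_
    rintro _ ⟨x', hx', rfl⟩
    exact hcmp x' hx' x hx
  have hf := h.density_pos θ hθ.2 x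
  have hf0 := h.density_pos θ₀ hθ₀ x
  have hratio : f θ x / f θ₀ x =
      Real.exp (G x + fderiv ℝ (loss f R x) θ (θ₀ - θ) + (R θ - R θ₀)) := by
    rw [← Real.exp_log (div_pos hf hf0), Real.log_div hf.ne' hf0.ne']
    congr 1
    simp only [hG, loss]
    ring
  have hlin : |fderiv ℝ (loss f R x) θ (θ₀ - θ)| ≤ σ * ρ * ‖impliedNoise f R σ x θ‖ := by
    have hnorm : ‖θ₀ - θ‖ ≤ ρ := by
      rw [norm_sub_rev, ← dist_eq_norm]
      exact hθ.1
    have hgrad : ‖∇ (loss f R x) θ‖ = σ * ‖impliedNoise f R σ x θ‖ := by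
      rw [impliedNoise, norm_neg, norm_smul, Real.norm_of_nonneg (inv_pos.2 hσ).le,
        mul_inv_cancel_left₀ hσ.ne']
    rw [← inner_gradient]
    refine (abs_real_inner_le_norm _ _).trans ?_
    rw [hgrad, mul_right_comm]
    gcongr
  obtain ⟨hl1, hl2⟩ := abs_le.1 hlin
  rw [hratio, Real.exp_le_exp, Real.exp_le_exp]
  constructor <;> linarith

end RegularityConditions

end LikelihoodRatio

/-! ### The expected bound -/

section Expectation

variable {d : ℕ} {S : Type*} [MeasurableSpace S]

instance isProbabilityMeasure_noiseLaw (d : ℕ) : IsProbabilityMeasure (noiseLaw d) := by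
  unfold noiseLaw
  infer_instance

/-- The bound of `lintegral_one_sub_tilt_le` with `κ = exp (5s/4 + e/2)`, in expectation over
independent data and noise. -/
lemma lintegral_tiltBound_le (hd : 0 < d) (P : Measure S) [IsProbabilityMeasure P] {Dp Dm : S → ℝ}
    (hDp : Measurable Dp) (hDm : Measurable Dm) (hDp0 : ∀ x, 0 ≤ Dp x)
    (hDm0 : ∀ x, 0 ≤ Dm x) {s e : ℝ}
    (hs : 0 ≤ s) (hs' : s ≤ 1 / 3) (he : 0 ≤ e)
    (hm : ∫⁻ x, ENNReal.ofReal (Dm x) ∂P ≤ ENNReal.ofReal e)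
    (hp : ∫⁻ x, ENNReal.ofReal (Real.exp (Dp x)) ∂P ≤ ENNReal.ofReal (Real.exp e)) :
    ∫⁻ p : S × EuclideanSpace ℝ (Fin d),
        ENNReal.ofReal (Real.log (Real.exp (5 / 4 * s + e / 2)) +
          Real.exp (s * ‖p.2‖ + Dp p.1 / 2) / Real.exp (5 / 4 * s + e / 2) - 1 +
          (s * ‖p.2‖ + Dm p.1 / 2)) ∂(P.prod (noiseLaw d)) ≤
      ENNReal.ofReal (5 / 2 * s + e) := by
  set k : ℝ := 5 / 4 * s with hk
  set a : EuclideanSpace ℝ (Fin d) → ℝ≥0∞ := fun w => ENNReal.ofReal (Real.exp (s * ‖w‖ - k)) with ha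
  set b : S → ℝ≥0∞ := fun x => ENNReal.ofReal (Real.exp (Dp x / 2 - e / 2)) with hb
  have ham : Measurable a := by fun_prop
  have hbm : Measurable b := by fun_prop
  have ha1 : ∫⁻ w, a w ∂(noiseLaw d) ≤ 1 := by
    have h1 : ∀ w, a w = ENNReal.ofReal (Real.exp (-k)) * ENNReal.ofReal (Real.exp (s * ‖w‖)) := by
      intro w
      rw [← ENNReal.ofReal_mul (Real.exp_pos _).le, ← Real.exp_add, neg_add_eq_sub]
    rw [lintegral_congr h1, lintegral_const_mul _ (by fun_prop)]
    calc _ ≤ ENNReal.ofReal (Real.exp (-k)) * ENNReal.ofReal (Real.exp (5 / 4 * s)) := by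
          gcongr
          exact lintegral_exp_norm_noiseLaw_le hd hs hs'
      _ = 1 := by
          rw [← ENNReal.ofReal_mul (Real.exp_pos _).le, ← Real.exp_add, hk]
          simp
  -- by the inequality of arithmetic and geometric means
  have hb1 : ∫⁻ x, b x ∂P ≤ 1 := by
    have h1 : ∀ x, b x ≤ ENNReal.ofReal (1 / 2) +
        ENNReal.ofReal (1 / 2 * Real.exp (-e)) * ENNReal.ofReal (Real.exp (Dp x)) := by
      intro x
      rw [← ENNReal.ofReal_mul (by positivity), ← ENNReal.ofReal_add (by positivity) (by positivity)]
      apply ENNReal.ofReal_le_ofReal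
      rw [mul_assoc, ← Real.exp_add]
      have h2 : Real.exp (-e + Dp x) = Real.exp (Dp x / 2 - e / 2) ^ 2 := by
        rw [← Real.exp_nat_mul]
        congr 1
        push_cast
        ring
      rw [h2]
      nlinarith [sq_nonneg (Real.exp (Dp x / 2 - e / 2) - 1)]
    calc _ ≤ ∫⁻ x, (ENNReal.ofReal (1 / 2) +
          ENNReal.ofReal (1 / 2 * Real.exp (-e)) * ENNReal.ofReal (Real.exp (Dp x))) ∂P :=
          lintegral_mono h1
      _ ≤ ENNReal.ofReal (1 / 2) +
          ENNReal.ofReal (1 / 2 * Real.exp (-e)) * ENNReal.ofReal (Real.exp e) := by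
          rw [lintegral_add_left measurable_const, lintegral_const_mul _ (by fun_prop)]
          simp only [lintegral_const, measure_univ, mul_one]
          gcongr
      _ = 1 := by
          rw [← ENNReal.ofReal_mul (by positivity), mul_assoc, ← Real.exp_add,
            ← ENNReal.ofReal_add (by positivity) (by positivity)]
          norm_num
  have hpt : ∀ p : S × EuclideanSpace ℝ (Fin d),
      ENNReal.ofReal (Real.log (Real.exp (k + e / 2)) +
          Real.exp (s * ‖p.2‖ + Dp p.1 / 2) / Real.exp (k + e / 2) - 1 +
          (s * ‖p.2‖ + Dm p.1 / 2)) + ENNReal.ofReal 2 ≤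
        ENNReal.ofReal (2 * k + e / 2) + b p.1 * a p.2 + a p.2 +
          ENNReal.ofReal (1 / 2) * ENNReal.ofReal (Dm p.1) := by
    intro p
    have h1 : Real.exp (s * ‖p.2‖ + Dp p.1 / 2) / Real.exp (k + e / 2) =
        Real.exp (Dp p.1 / 2 - e / 2) * Real.exp (s * ‖p.2‖ - k) := by
      rw [← Real.exp_sub, ← Real.exp_add]
      congr 1
      ring
    have h2 := Real.add_one_le_exp (s * ‖p.2‖ - k)
    have hk0 : 0 ≤ k := by positivity
    have h0 := hDm0 p.1
    have hprod : 0 ≤ Real.exp (Dp p.1 / 2 - e / 2) * Real.exp (s * ‖p.2‖ - k) := by positivity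
    have hs0 : 0 ≤ s * ‖p.2‖ := by positivity
    have hnonneg : 0 ≤ Real.log (Real.exp (k + e / 2)) +
        Real.exp (s * ‖p.2‖ + Dp p.1 / 2) / Real.exp (k + e / 2) - 1 +
        (s * ‖p.2‖ + Dm p.1 / 2) := by
      have h3 := Real.add_one_le_exp (s * ‖p.2‖ + Dp p.1 / 2 - (k + e / 2))
      rw [Real.exp_sub] at h3
      rw [Real.log_exp]
      linarith [hDp0 p.1]
    rw [ha, hb, ← ENNReal.ofReal_add hnonneg zero_le_two,
      ← ENNReal.ofReal_mul (Real.exp_pos _).le, ← ENNReal.ofReal_mul (by norm_num),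
      ← ENNReal.ofReal_add (by positivity) hprod,
      ← ENNReal.ofReal_add (by positivity) (Real.exp_pos _).le,
      ← ENNReal.ofReal_add (by positivity) (by positivity)]
    apply ENNReal.ofReal_le_ofReal
    rw [Real.log_exp, h1]
    linarith
  have hprodint : ∫⁻ p : S × EuclideanSpace ℝ (Fin d), b p.1 * a p.2 ∂(P.prod (noiseLaw d)) ≤ 1 := by
    rw [lintegral_prod_mul hbm.aemeasurable ham.aemeasurable]
    exact mul_le_one' hb1 ha1
  have haint : ∫⁻ p : S × EuclideanSpace ℝ (Fin d), a p.2 ∂(P.prod (noiseLaw d)) ≤ 1 := by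
    rw [lintegral_prod _ (by fun_prop)]
    simpa using ha1
  have hDint : ∫⁻ p : S × EuclideanSpace ℝ (Fin d),
      ENNReal.ofReal (1 / 2) * ENNReal.ofReal (Dm p.1) ∂(P.prod (noiseLaw d)) ≤
      ENNReal.ofReal (e / 2) := by
    rw [lintegral_const_mul _ (by fun_prop), lintegral_prod _ (by fun_prop)]
    simp only [lintegral_const, measure_univ, mul_one]
    rw [show e / 2 = 1 / 2 * e by ring, ENNReal.ofReal_mul (by norm_num)]
    gcongr
  refine (ENNReal.add_le_add_iff_right (ENNReal.ofReal_ne_top (r := 2))).1 ?_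
  calc _ = ∫⁻ p : S × EuclideanSpace ℝ (Fin d),
        (ENNReal.ofReal (Real.log (Real.exp (k + e / 2)) +
          Real.exp (s * ‖p.2‖ + Dp p.1 / 2) / Real.exp (k + e / 2) - 1 +
          (s * ‖p.2‖ + Dm p.1 / 2)) + ENNReal.ofReal 2) ∂(P.prod (noiseLaw d)) := by
        rw [lintegral_add_right _ measurable_const]
        simp
    _ ≤ ∫⁻ p : S × EuclideanSpace ℝ (Fin d),
        (ENNReal.ofReal (2 * k + e / 2) + b p.1 * a p.2 + a p.2 +
          ENNReal.ofReal (1 / 2) * ENNReal.ofReal (Dm p.1)) ∂(P.prod (noiseLaw d)) :=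
        lintegral_mono hpt
    _ ≤ ENNReal.ofReal (2 * k + e / 2) + 1 + 1 + ENNReal.ofReal (e / 2) := by
        rw [lintegral_add_left (by fun_prop), lintegral_add_left (by fun_prop),
          lintegral_add_left (by fun_prop), lintegral_const, measure_univ, mul_one]
        gcongr
    _ = ENNReal.ofReal (5 / 2 * s + e) + ENNReal.ofReal 2 := by
        rw [← ENNReal.ofReal_one, ← ENNReal.ofReal_add (by positivity) (by positivity),
          ← ENNReal.ofReal_add (by positivity) (by positivity),
          ← ENNReal.ofReal_add (by positivity) (by positivity),
          ← ENNReal.ofReal_add (by positivity) (by positivity), hk]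
        congr 1
        ring

end Expectation

/-! ### The plug-in mixture -/

section Mixture

variable {d M : ℕ} {S : Type*} [MeasurableSpace S]

lemma measurable_finCons :
    Measurable fun q : S × (Fin M → S) => (Fin.cons q.1 q.2 : Fin (M + 1) → S) := by
  refine measurable_pi_iff.2 fun i => ?_
  refine Fin.cases ?_ (fun j => ?_) i
  · simpa using measurable_fst
  · simp only [Fin.cons_succ]
    exact (measurable_pi_apply j).comp measurable_snd

/-- The weight `f(x;θ') · selectionWeight θ x`. For `θ' = θ` it is the unnormalized density of
`p_θ(· | θ)`; for `θ' = θ₀` it is, up to a constant, the joint density of data and estimator when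
the data are drawn from `P_{θ₀}`. -/
noncomputable def dataWeight (f : EuclideanSpace ℝ (Fin d) → S → ℝ)
    (R : EuclideanSpace ℝ (Fin d) → ℝ) (σ : ℝ)
    (θhat : S → EuclideanSpace ℝ (Fin d) → EuclideanSpace ℝ (Fin d))
    (θ' θ : EuclideanSpace ℝ (Fin d)) (x : S) : ℝ≥0∞ :=
  ENNReal.ofReal (f θ' x) * ENNReal.ofReal (selectionWeight f R σ θhat θ x)

/-- The total mass of `dataWeight` with respect to the base measure. -/
noncomputable def totalWeight (ν : Measure S) (f : EuclideanSpace ℝ (Fin d) → S → ℝ)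
    (R : EuclideanSpace ℝ (Fin d) → ℝ) (σ : ℝ)
    (θhat : S → EuclideanSpace ℝ (Fin d) → EuclideanSpace ℝ (Fin d))
    (θ' θ : EuclideanSpace ℝ (Fin d)) : ℝ≥0∞ :=
  ∫⁻ x, dataWeight f R σ θhat θ' θ x ∂ν

/-- The constant factor in the joint density of data and estimator: the Gaussian normalizing
constant times the constant part `σ⁻ᵈ` of the Jacobian. -/
noncomputable def jacobianConst (d : ℕ) (σ : ℝ) : ℝ≥0∞ :=
  ENNReal.ofReal (noiseConst d * (σ⁻¹) ^ d)

lemma jacobianConst_ne_zero (hd : 0 < d) {σ : ℝ} (hσ : 0 < σ) : jacobianConst d σ ≠ 0 := by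
  have := noiseConst_pos hd
  have h : 0 < noiseConst d * (σ⁻¹) ^ d := by positivity
  simpa [jacobianConst] using h

/-- The conditional probability that `(x, copies)` lies in `A` if the copies are drawn with
estimator value `θ`. -/
noncomputable def sampleProb (Pt : Kernel (S × EuclideanSpace ℝ (Fin d)) (Fin M → S))
    (A : Set (Fin (M + 1) → S)) (x : S) (θ : EuclideanSpace ℝ (Fin d)) : ℝ≥0∞ :=
  Pt (x, θ) {y | (Fin.cons x y : Fin (M + 1) → S) ∈ A}

lemma measurable_sampleProb (Pt : Kernel (S × EuclideanSpace ℝ (Fin d)) (Fin M → S))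
    [IsMarkovKernel Pt] {A : Set (Fin (M + 1) → S)} (hA : MeasurableSet A) :
    Measurable fun p : S × EuclideanSpace ℝ (Fin d) => sampleProb Pt A p.1 p.2 := by
  have hm : Measurable fun q : (S × EuclideanSpace ℝ (Fin d)) × (Fin M → S) =>
      (Fin.cons q.1.1 q.2 : Fin (M + 1) → S) :=
    measurable_finCons.comp ((measurable_fst.comp measurable_fst).prodMk measurable_snd)
  exact Kernel.measurable_kernel_prodMk_left (hm hA)

lemma sampleProb_le_one (Pt : Kernel (S × EuclideanSpace ℝ (Fin d)) (Fin M → S))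
    [IsMarkovKernel Pt] (A : Set (Fin (M + 1) → S)) (x : S) (θ : EuclideanSpace ℝ (Fin d)) :
    sampleProb Pt A x θ ≤ 1 := prob_le_one

/-- The law of `(X, copies)` restricted to estimator values in `B`, except that given the value `θ`
of the estimator the data are drawn from the plug-in density `p_θ(· | θ)` in place of its true
conditional density. The factor `totalWeight θ₀ θ / totalWeight θ θ` keeps the law of the
estimator. -/
noncomputable def plugInMixture (ν : Measure S) (f : EuclideanSpace ℝ (Fin d) → S → ℝ)
    (R : EuclideanSpace ℝ (Fin d) → ℝ) (σ : ℝ)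
    (θhat : S → EuclideanSpace ℝ (Fin d) → EuclideanSpace ℝ (Fin d))
    (Pt : Kernel (S × EuclideanSpace ℝ (Fin d)) (Fin M → S)) (θ₀ : EuclideanSpace ℝ (Fin d))
    (B : Set (EuclideanSpace ℝ (Fin d))) : Measure (Fin (M + 1) → S) :=
  (((ν.prod (volume.restrict B)).withDensity fun p => jacobianConst d σ *
    (totalWeight ν f R σ θhat θ₀ p.2 / totalWeight ν f R σ θhat p.2 p.2 *
      dataWeight f R σ θhat p.2 p.2 p.1)) ⊗ₘ Pt).map
    fun q => (Fin.cons q.1.1 q.2 : Fin (M + 1) → S)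

variable {Θ : Set (EuclideanSpace ℝ (Fin d))} {ν : Measure S}
  {f : EuclideanSpace ℝ (Fin d) → S → ℝ} {R : EuclideanSpace ℝ (Fin d) → ℝ} {σ : ℝ}
  {θhat : S → EuclideanSpace ℝ (Fin d) → EuclideanSpace ℝ (Fin d)}
  {θ θ₀ : EuclideanSpace ℝ (Fin d)}
  {Pt : Kernel (S × EuclideanSpace ℝ (Fin d)) (Fin M → S)}

namespace RegularityConditions

lemma sFinite (h : RegularityConditions Θ ν f R) (hθ₀ : θ₀ ∈ Θ) : SFinite ν := by
  have hP := h.isProbabilityMeasure θ₀ hθ₀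
  have h1 := withDensity_inv_same (μ := ν) (f := fun x => ENNReal.ofReal (f θ₀ x))
    (h.measurable_density θ₀ hθ₀).ennreal_ofReal
    (Filter.Eventually.of_forall fun x => by simpa using h.density_pos θ₀ hθ₀ x)
    (Filter.Eventually.of_forall fun x => ENNReal.ofReal_ne_top)
  rw [← h1]
  change SFinite ((modelLaw ν f θ₀).withDensity _)
  infer_instance

lemma ae_base_of_ae_modelLaw (h : RegularityConditions Θ ν f R) (hθ₀ : θ₀ ∈ Θ) {p : S → Prop}
    (hp : ∀ᵐ x ∂(modelLaw ν f θ₀), p x) : ∀ᵐ x ∂ν, p x :=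
  (withDensity_absolutelyContinuous' (h.measurable_density θ₀ hθ₀).ennreal_ofReal.aemeasurable
    (Filter.Eventually.of_forall fun x => by simpa using h.density_pos θ₀ hθ₀ x)).ae_le hp

lemma measurable_dataWeight (h : RegularityConditions Θ ν f R) (hσ : 0 < σ)
    (hmeas : Measurable (Function.uncurry θhat)) (hmem : ∀ x w, θhat x w ∈ Θ) (hθ₀ : θ₀ ∈ Θ) :
    Measurable fun p : S × EuclideanSpace ℝ (Fin d) => dataWeight f R σ θhat θ₀ p.2 p.1 :=
  ((h.measurable_density θ₀ hθ₀).comp measurable_fst).ennreal_ofReal.mul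
    (h.measurable_selectionWeight hσ hmeas hmem).ennreal_ofReal

lemma measurable_dataWeight_self (h : RegularityConditions Θ ν f R) (hσ : 0 < σ)
    (hmeas : Measurable (Function.uncurry θhat)) (hmem : ∀ x w, θhat x w ∈ Θ) :
    Measurable fun p : S × EuclideanSpace ℝ (Fin d) => dataWeight f R σ θhat p.2 p.2 p.1 := by
  have h1 := h.measurable_indicator_density.ennreal_ofReal.mul
    (h.measurable_selectionWeight hσ hmeas hmem).ennreal_ofReal
  convert h1 using 1
  funext p
  by_cases hp : p.2 ∈ Θ
  · simp [dataWeight, hp]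
  · simp [dataWeight, h.selectionWeight_eq_zero hσ hmem hp]

lemma ofReal_unnormDensity (h : RegularityConditions Θ ν f R) (hθ : θ ∈ Θ) (x : S) :
    ENNReal.ofReal (unnormDensity f R σ θhat θ x) = dataWeight f R σ θhat θ θ x := by
  rw [unnormDensity_eq_mul, ENNReal.ofReal_mul (h.density_pos θ hθ x).le, dataWeight]

/-- Expectations over data and noise, on the event that the estimator is a SSOSP, in terms of the
joint density of data and estimator. -/
lemma lintegral_prod_isSSOSP_eq (h : RegularityConditions Θ ν f R) (hd : 0 < d) (hσ : 0 < σ)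
    (hmeas : Measurable (Function.uncurry θhat)) (hmem : ∀ x w, θhat x w ∈ Θ) (hθ₀ : θ₀ ∈ Θ)
    {G : S → EuclideanSpace ℝ (Fin d) → EuclideanSpace ℝ (Fin d) → ℝ≥0∞}
    (hG : Measurable fun q : S × EuclideanSpace ℝ (Fin d) × EuclideanSpace ℝ (Fin d) =>
      G q.1 q.2.1 q.2.2) :
    ∫⁻ p in {p | IsSSOSP (perturbedLoss f R σ p.1 p.2) (θhat p.1 p.2)},
        G p.1 p.2 (θhat p.1 p.2) ∂((modelLaw ν f θ₀).prod (noiseLaw d)) =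
      ∫⁻ θ, jacobianConst d σ * ∫⁻ x, dataWeight f R σ θhat θ₀ θ x *
        G x (impliedNoise f R σ x θ) θ ∂ν := by
  have := h.sFinite hθ₀
  have := h.isProbabilityMeasure θ₀ hθ₀
  have hset := h.measurableSet_isSSOSP hσ hmeas hmem
  have hGm : Measurable fun p : S × EuclideanSpace ℝ (Fin d) => G p.1 p.2 (θhat p.1 p.2) :=
    hG.comp (measurable_fst.prodMk (measurable_snd.prodMk hmeas))
  have hsel := h.measurable_selectionWeight hσ hmeas hmem
  -- the weight vanishes off `Θ`, where the implied noise need not be measurable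
  have hw : ∀ (x : S) (θ : EuclideanSpace ℝ (Fin d)),
      ENNReal.ofReal (selectionWeight f R σ θhat θ x) * G x (impliedNoise f R σ x θ) θ =
      ENNReal.ofReal (selectionWeight f R σ θhat θ x) *
        G x (Θ.indicator (impliedNoise f R σ x) θ) θ := by
    intro x θ
    by_cases hθ : θ ∈ Θ
    · rw [Set.indicator_of_mem hθ]
    · rw [h.selectionWeight_eq_zero hσ hmem hθ]
      simp
  have hwm : Measurable fun p : S × EuclideanSpace ℝ (Fin d) =>
      ENNReal.ofReal (selectionWeight f R σ θhat p.2 p.1) *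
        G p.1 (Θ.indicator (impliedNoise f R σ p.1) p.2) p.2 :=
    hsel.ennreal_ofReal.mul (hG.comp (measurable_fst.prodMk
      ((h.measurable_indicator_impliedNoise σ).prodMk measurable_snd)))
  have hfm := (h.measurable_density θ₀ hθ₀).ennreal_ofReal
  have hinner : ∀ x, ∫⁻ w, Set.indicator
      {p : S × EuclideanSpace ℝ (Fin d) | IsSSOSP (perturbedLoss f R σ p.1 p.2) (θhat p.1 p.2)}
      (fun p => G p.1 p.2 (θhat p.1 p.2)) (x, w) ∂(noiseLaw d) =
      ∫⁻ θ, jacobianConst d σ * (ENNReal.ofReal (selectionWeight f R σ θhat θ x) *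
        G x (Θ.indicator (impliedNoise f R σ x) θ) θ) := by
    intro x
    have hm1 : Measurable fun w => Set.indicator
        {p : S × EuclideanSpace ℝ (Fin d) | IsSSOSP (perturbedLoss f R σ p.1 p.2) (θhat p.1 p.2)}
        (fun p => G p.1 p.2 (θhat p.1 p.2)) (x, w) :=
      (hGm.indicator hset).comp measurable_prodMk_left
    rw [noiseLaw_eq_withDensity hd, lintegral_withDensity_eq_lintegral_mul _ (by fun_prop) hm1]
    simp_rw [← hw]
    have hset' : MeasurableSet {w | IsSSOSP (perturbedLoss f R σ x w) (θhat x w)} :=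
      measurable_prodMk_left hset
    rw [jacobianConst, ← h.lintegral_isSSOSP_eq hd hσ hmeas hmem x (G x),
      ← lintegral_indicator hset']
    refine lintegral_congr fun w => ?_
    by_cases hwm : IsSSOSP (perturbedLoss f R σ x w) (θhat x w)
    · simp [Set.indicator, hwm]
    · simp [Set.indicator, hwm]
  rw [← lintegral_indicator hset, lintegral_prod _ (hGm.indicator hset).aemeasurable,
    lintegral_congr hinner, modelLaw,
    lintegral_withDensity_eq_lintegral_mul _ hfm
      (Measurable.lintegral_prod_right' (f := fun p : S × EuclideanSpace ℝ (Fin d) =>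
        jacobianConst d σ * (ENNReal.ofReal (selectionWeight f R σ θhat p.2 p.1) *
          G p.1 (Θ.indicator (impliedNoise f R σ p.1) p.2) p.2)) (hwm.const_mul _))]
  calc _ = ∫⁻ x, (∫⁻ θ, ENNReal.ofReal (f θ₀ x) * (jacobianConst d σ *
        (ENNReal.ofReal (selectionWeight f R σ θhat θ x) *
          G x (Θ.indicator (impliedNoise f R σ x) θ) θ))) ∂ν := by
        refine lintegral_congr fun x => ?_
        have hm : Measurable fun θ => jacobianConst d σ *
            (ENNReal.ofReal (selectionWeight f R σ θhat θ x) *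
              G x (Θ.indicator (impliedNoise f R σ x) θ) θ) :=
          (hwm.const_mul _).comp measurable_prodMk_left
        exact (lintegral_const_mul _ hm).symm
    _ = ∫⁻ θ, ∫⁻ x, ENNReal.ofReal (f θ₀ x) * (jacobianConst d σ *
        (ENNReal.ofReal (selectionWeight f R σ θhat θ x) *
          G x (Θ.indicator (impliedNoise f R σ x) θ) θ)) ∂ν := by
        refine lintegral_lintegral_swap (Measurable.aemeasurable ?_)
        exact (hfm.comp measurable_fst).mul (hwm.const_mul _)
    _ = _ := by
        refine lintegral_congr fun θ => ?_
        rw [← lintegral_const_mul' _ _ (by simp [jacobianConst])]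
        refine lintegral_congr fun x => ?_
        rw [← hw, dataWeight]
        ring

lemma measurable_totalWeight (h : RegularityConditions Θ ν f R) (hσ : 0 < σ)
    (hmeas : Measurable (Function.uncurry θhat)) (hmem : ∀ x w, θhat x w ∈ Θ) (hθ₀ : θ₀ ∈ Θ) :
    Measurable (totalWeight ν f R σ θhat θ₀) :=
  have := h.sFinite hθ₀
  (h.measurable_dataWeight hσ hmeas hmem hθ₀).lintegral_prod_left'

lemma measurable_totalWeight_self (h : RegularityConditions Θ ν f R) (hσ : 0 < σ)
    (hmeas : Measurable (Function.uncurry θhat)) (hmem : ∀ x w, θhat x w ∈ Θ) (hθ₀ : θ₀ ∈ Θ) :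
    Measurable fun θ => totalWeight ν f R σ θhat θ θ :=
  have := h.sFinite hθ₀
  (h.measurable_dataWeight_self hσ hmeas hmem).lintegral_prod_left'

lemma plugInMixture_apply (h : RegularityConditions Θ ν f R) (hσ : 0 < σ)
    (hmeas : Measurable (Function.uncurry θhat)) (hmem : ∀ x w, θhat x w ∈ Θ) (hθ₀ : θ₀ ∈ Θ)
    [IsMarkovKernel Pt] (B : Set (EuclideanSpace ℝ (Fin d))) {A : Set (Fin (M + 1) → S)}
    (hA : MeasurableSet A) :
    plugInMixture ν f R σ θhat Pt θ₀ B A =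
      ∫⁻ θ in B, jacobianConst d σ *
        ∫⁻ x, totalWeight ν f R σ θhat θ₀ θ / totalWeight ν f R σ θhat θ θ *
          dataWeight f R σ θhat θ θ x * sampleProb Pt A x θ ∂ν := by
  have := h.sFinite hθ₀
  have hm : Measurable fun q : (S × EuclideanSpace ℝ (Fin d)) × (Fin M → S) =>
      (Fin.cons q.1.1 q.2 : Fin (M + 1) → S) :=
    measurable_finCons.comp ((measurable_fst.comp measurable_fst).prodMk measurable_snd)
  have hdens : Measurable fun p : S × EuclideanSpace ℝ (Fin d) => jacobianConst d σ *
      (totalWeight ν f R σ θhat θ₀ p.2 / totalWeight ν f R σ θhat p.2 p.2 *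
        dataWeight f R σ θhat p.2 p.2 p.1) :=
    ((((h.measurable_totalWeight hσ hmeas hmem hθ₀).comp measurable_snd).div
      ((h.measurable_totalWeight_self hσ hmeas hmem hθ₀).comp measurable_snd)).mul
      (h.measurable_dataWeight_self hσ hmeas hmem)).const_mul _
  have hK := measurable_sampleProb Pt hA
  rw [plugInMixture, Measure.map_apply hm hA, Measure.compProd_apply (hm hA)]
  change ∫⁻ p : S × EuclideanSpace ℝ (Fin d), sampleProb Pt A p.1 p.2 ∂_ = _
  rw [lintegral_withDensity_eq_lintegral_mul _ hdens hK,
    lintegral_prod_symm' _ (hdens.mul hK)]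
  refine lintegral_congr fun θ => ?_
  rw [← lintegral_const_mul' _ _ (by simp [jacobianConst])]
  refine lintegral_congr fun x => ?_
  simp only [Pi.mul_apply]
  ring

lemma map_plugInLaw_compProd_apply (h : RegularityConditions Θ ν f R) (hσ : 0 < σ)
    (hmeas : Measurable (Function.uncurry θhat)) (hmem : ∀ x w, θhat x w ∈ Θ) (hθ : θ ∈ Θ)
    [IsMarkovKernel Pt] {A : Set (Fin (M + 1) → S)} (hA : MeasurableSet A) :
    ((plugInLaw ν f R σ θhat θ ⊗ₘ Pt.comap (fun x => (x, θ)) measurable_prodMk_right).map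
        fun p : S × (Fin M → S) => (Fin.cons p.1 p.2 : Fin (M + 1) → S)) A =
      (totalWeight ν f R σ θhat θ θ)⁻¹ *
        ∫⁻ x, dataWeight f R σ θhat θ θ x * sampleProb Pt A x θ ∂ν := by
  have := h.sFinite hθ
  have hplug : plugInLaw ν f R σ θhat θ = (totalWeight ν f R σ θhat θ θ)⁻¹ •
      ν.withDensity (dataWeight f R σ θhat θ θ) := by
    unfold plugInLaw totalWeight
    simp_rw [h.ofReal_unnormDensity hθ]
  have hwm : Measurable (dataWeight f R σ θhat θ θ) :=
    (h.measurable_dataWeight hσ hmeas hmem hθ).comp measurable_prodMk_right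
  have hKm : Measurable fun x => sampleProb Pt A x θ :=
    (measurable_sampleProb Pt hA).comp measurable_prodMk_right
  rw [hplug, Measure.map_apply measurable_finCons hA,
    Measure.compProd_apply (measurable_finCons hA)]
  change ∫⁻ x, sampleProb Pt A x θ ∂_ = _
  rw [lintegral_smul_measure, lintegral_withDensity_eq_lintegral_mul _ hwm hKm]
  rfl

/-- The plug-in mixture is exchangeable, as a mixture of exchangeable laws. -/
lemma isExchangeable_plugInMixture (h : RegularityConditions Θ ν f R) (hσ : 0 < σ)
    (hmeas : Measurable (Function.uncurry θhat)) (hmem : ∀ x w, θhat x w ∈ Θ) (hθ₀ : θ₀ ∈ Θ)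
    [IsMarkovKernel Pt] (hPt : SamplerExchangeable Θ ν f R σ θhat Pt)
    {B : Set (EuclideanSpace ℝ (Fin d))} (hB : MeasurableSet B) (hBΘ : B ⊆ Θ) :
    IsExchangeable (plugInMixture ν f R σ θhat Pt θ₀ B) := by
  intro π
  ext A hA
  have hπ : Measurable fun (b : Fin (M + 1) → S) i => b (π i) := by fun_prop
  rw [Measure.map_apply hπ hA, h.plugInMixture_apply hσ hmeas hmem hθ₀ B (hπ hA),
    h.plugInMixture_apply hσ hmeas hmem hθ₀ B hA]
  refine setLIntegral_congr_fun hB fun θ hθB => ?_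
  have hθ := hBΘ hθB
  congr 1
  by_cases hpos : 0 < ν (supportSet f R σ θhat θ)
  · have hfactor : ∀ {A' : Set (Fin (M + 1) → S)}, MeasurableSet A' →
        ∫⁻ x, totalWeight ν f R σ θhat θ₀ θ / totalWeight ν f R σ θhat θ θ *
          dataWeight f R σ θhat θ θ x * sampleProb Pt A' x θ ∂ν =
        totalWeight ν f R σ θhat θ₀ θ *
          ((plugInLaw ν f R σ θhat θ ⊗ₘ Pt.comap (fun x => (x, θ)) measurable_prodMk_right).map
            fun p : S × (Fin M → S) => (Fin.cons p.1 p.2 : Fin (M + 1) → S)) A' := by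
      intro A' hA'
      rw [h.map_plugInLaw_compProd_apply hσ hmeas hmem hθ hA', ← mul_assoc, ← div_eq_mul_inv,
        ← lintegral_const_mul]
      · simp only [mul_assoc]
      · exact ((h.measurable_dataWeight hσ hmeas hmem hθ).comp measurable_prodMk_right).mul
          ((measurable_sampleProb Pt hA').comp measurable_prodMk_right)
    rw [hfactor (hπ hA), hfactor hA, (hPt θ hθ hpos).measure_preimage π hA]
  · -- if `𝓧_θ` is a null set then the weight vanishes almost everywhere
    have h0 : ν (supportSet f R σ θhat θ) = 0 := by simpa using hpos
    have hae : ∀ᵐ x ∂ν, dataWeight f R σ θhat θ θ x = 0 := by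
      filter_upwards [measure_eq_zero_iff_ae_notMem.1 h0] with x hx
      simp [dataWeight, selectionWeight, hx]
    refine lintegral_congr_ae ?_
    filter_upwards [hae] with x hx
    simp [hx]

/-- Given the value `θ` of the estimator, the part of the true conditional law of the data that is
not covered by the plug-in law. -/
lemma lintegral_dataWeight_sub_le (h : RegularityConditions Θ ν f R) (hσ : 0 < σ)
    (hmeas : Measurable (Function.uncurry θhat)) (hmem : ∀ x w, θhat x w ∈ Θ) (hθ₀ : θ₀ ∈ Θ)
    {ρ : ℝ} (hρ : 0 ≤ ρ) (hθ : θ ∈ Metric.closedBall θ₀ ρ ∩ Θ) {Dp Dm : S → ℝ}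
    (hDpm : Measurable Dp) (hDmm : Measurable Dm)
    (hDp : ∀ x, 0 ≤ Dp x) (hDm : ∀ x, 0 ≤ Dm x)
    (hup : ∀ᵐ x ∂(modelLaw ν f θ₀), supLambdaMax Θ θ₀ ρ
      (fun θ => obsInfo f θ x - meanInfo ν f θ₀ θ) ≤ ENNReal.ofReal (Dp x))
    (hlo : ∀ᵐ x ∂(modelLaw ν f θ₀), supLambdaMax Θ θ₀ ρ
      (fun θ => meanInfo ν f θ₀ θ - obsInfo f θ x) ≤ ENNReal.ofReal (Dm x))
    {κ : ℝ} (hκ : 1 ≤ κ) (hfin : totalWeight ν f R σ θhat θ₀ θ ≠ ∞) :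
    ∫⁻ x, (dataWeight f R σ θhat θ₀ θ x -
        totalWeight ν f R σ θhat θ₀ θ / totalWeight ν f R σ θhat θ θ *
          dataWeight f R σ θhat θ θ x) ∂ν ≤
      ∫⁻ x, dataWeight f R σ θhat θ₀ θ x * ENNReal.ofReal (Real.log κ +
        Real.exp (σ * ρ * ‖impliedNoise f R σ x θ‖ + Dp x / 2) / κ - 1 +
        (σ * ρ * ‖impliedNoise f R σ x θ‖ + Dm x / 2)) ∂ν := by
  have := h.isProbabilityMeasure θ₀ hθ₀
  have hw0 : Measurable (dataWeight f R σ θhat θ₀ θ) :=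
    (h.measurable_dataWeight hσ hmeas hmem hθ₀).comp measurable_prodMk_right
  have hnoise : Measurable fun x => impliedNoise f R σ x θ := by
    have := (h.measurable_indicator_impliedNoise σ).comp (measurable_prodMk_right (y := θ))
    simpa [Function.comp_def, Set.indicator_of_mem hθ.2] using this
  set m : Measure S := ν.withDensity (dataWeight f R σ θhat θ₀ θ) with hm
  have hmfin : IsFiniteMeasure m := isFiniteMeasure_withDensity hfin
  have hymeas : Measurable fun x => f θ x / f θ₀ x :=
    (h.measurable_density θ hθ.2).div (h.measurable_density θ₀ hθ₀)
  have hS₀ : ∀ᵐ x ∂(modelLaw ν f θ₀), x ∈ {x |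
      supLambdaMax Θ θ₀ ρ (fun θ => obsInfo f θ x - meanInfo ν f θ₀ θ) ≤ ENNReal.ofReal (Dp x) ∧
      supLambdaMax Θ θ₀ ρ (fun θ => meanInfo ν f θ₀ θ - obsInfo f θ x) ≤ ENNReal.ofReal (Dm x)} :=
    hup.and hlo
  obtain ⟨C, hC⟩ := h.exists_likelihoodRatio_bounds hσ hθ₀ hθ hS₀.exists hDp hDm
    (fun x hx => hx.1) (fun x hx => hx.2)
  have hS₀m : ∀ᵐ x ∂m, x ∈ {x |
      supLambdaMax Θ θ₀ ρ (fun θ => obsInfo f θ x - meanInfo ν f θ₀ θ) ≤ ENNReal.ofReal (Dp x) ∧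
      supLambdaMax Θ θ₀ ρ (fun θ => meanInfo ν f θ₀ θ - obsInfo f θ x) ≤ ENNReal.ofReal (Dm x)} :=
    (withDensity_absolutelyContinuous ν _).ae_le (h.ae_base_of_ae_modelLaw hθ₀ hS₀)
  have hUm : Measurable fun x => σ * ρ * ‖impliedNoise f R σ x θ‖ + Dp x / 2 :=
    (hnoise.norm.const_mul _).add (hDpm.div_const _)
  have hVm : Measurable fun x => σ * ρ * ‖impliedNoise f R σ x θ‖ + Dm x / 2 :=
    (hnoise.norm.const_mul _).add (hDmm.div_const _)
  have key := lintegral_one_sub_tilt_le m (C := C) hymeas hUm hVm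
    (fun x => by have := hDp x; positivity) (fun x => by have := hDm x; positivity) hκ
    (hS₀m.mono fun x hx => (hC x hx).1) (hS₀m.mono fun x hx => (hC x hx).2)
  have hcancel : ∀ x, dataWeight f R σ θhat θ₀ θ x * ENNReal.ofReal (f θ x / f θ₀ x) =
      dataWeight f R σ θhat θ θ x := by
    intro x
    have hf0 := h.density_pos θ₀ hθ₀ x
    rw [dataWeight, dataWeight, mul_right_comm, ← ENNReal.ofReal_mul hf0.le,
      mul_div_cancel₀ _ hf0.ne']
  have htot : m Set.univ = totalWeight ν f R σ θhat θ₀ θ := by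
    rw [hm, withDensity_apply _ MeasurableSet.univ, Measure.restrict_univ, totalWeight]
  have htot' : ∫⁻ x, ENNReal.ofReal (f θ x / f θ₀ x) ∂m = totalWeight ν f R σ θhat θ θ := by
    rw [hm, lintegral_withDensity_eq_lintegral_mul _ hw0 hymeas.ennreal_ofReal, totalWeight]
    exact lintegral_congr fun x => hcancel x
  have hLm : Measurable fun x => 1 - totalWeight ν f R σ θhat θ₀ θ /
      totalWeight ν f R σ θhat θ θ * ENNReal.ofReal (f θ x / f θ₀ x) :=
    measurable_const.sub (hymeas.ennreal_ofReal.const_mul _)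
  have hZm : Measurable fun x => ENNReal.ofReal (Real.log κ +
      Real.exp (σ * ρ * ‖impliedNoise f R σ x θ‖ + Dp x / 2) / κ - 1 +
      (σ * ρ * ‖impliedNoise f R σ x θ‖ + Dm x / 2)) :=
    (((measurable_const.add (hUm.exp.div_const κ)).sub measurable_const).add hVm).ennreal_ofReal
  rw [htot, htot', hm, lintegral_withDensity_eq_lintegral_mul _ hw0 hLm,
    lintegral_withDensity_eq_lintegral_mul _ hw0 hZm] at key
  refine le_trans (le_of_eq (lintegral_congr fun x => ?_)) key
  have hne : dataWeight f R σ θhat θ₀ θ x ≠ ∞ :=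
    ENNReal.mul_ne_top ENNReal.ofReal_ne_top ENNReal.ofReal_ne_top
  rw [Pi.mul_apply, ENNReal.mul_sub fun _ _ => hne, mul_one, mul_left_comm,
    hcancel]

end RegularityConditions

end Mixture

/-! ### Distance of the aCSS law from the plug-in mixture -/

section Distance

variable {d M : ℕ} {S Ω : Type*} [MeasurableSpace S] [MeasurableSpace Ω]
  {Θ : Set (EuclideanSpace ℝ (Fin d))} {ν : Measure S}
  {f : EuclideanSpace ℝ (Fin d) → S → ℝ} {R : EuclideanSpace ℝ (Fin d) → ℝ} {σ : ℝ}
  {θhat : S → EuclideanSpace ℝ (Fin d) → EuclideanSpace ℝ (Fin d)}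
  {θ₀ : EuclideanSpace ℝ (Fin d)}
  {Pt : Kernel (S × EuclideanSpace ℝ (Fin d)) (Fin M → S)}

lemma exists_measurable_real_version {P : Measure S} {D : S → ℝ≥0∞} (hD : AEMeasurable D P)
    (hfin : ∀ᵐ x ∂P, D x < ∞) :
    ∃ D' : S → ℝ, Measurable D' ∧ (∀ x, 0 ≤ D' x) ∧ ∀ᵐ x ∂P, D x = ENNReal.ofReal (D' x) := by
  refine ⟨fun x => (hD.mk D x).toReal, hD.measurable_mk.ennreal_toReal,
    fun x => ENNReal.toReal_nonneg, ?_⟩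
  filter_upwards [hfin, hD.ae_eq_mk] with x hx hx'
  rw [← hx', ENNReal.ofReal_toReal hx.ne]

namespace HessianConcentrationAt

variable {ρ e : ℝ}

lemma nonneg (hc : HessianConcentrationAt Θ ν f θ₀ ρ e)
    [IsProbabilityMeasure (modelLaw ν f θ₀)] : 0 ≤ e := by
  have h1 : (1 : ℝ≥0∞) ≤ ENNReal.ofReal (Real.exp e) := by
    refine le_trans ?_ hc.upper
    calc (1 : ℝ≥0∞) = ∫⁻ _, 1 ∂(modelLaw ν f θ₀) := by simp
      _ ≤ _ := lintegral_mono fun x => EReal.one_le_exp_iff.2 (EReal.coe_ennreal_nonneg _)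
  rw [ENNReal.one_le_ofReal] at h1
  exact Real.one_le_exp_iff.1 h1

/-- Everywhere finite, measurable versions of the two suprema in the concentration conditions. -/
lemma exists_deviations (hc : HessianConcentrationAt Θ ν f θ₀ ρ e) :
    ∃ Dp Dm : S → ℝ, Measurable Dp ∧ Measurable Dm ∧ (∀ x, 0 ≤ Dp x) ∧ (∀ x, 0 ≤ Dm x) ∧
      (∀ᵐ x ∂(modelLaw ν f θ₀), supLambdaMax Θ θ₀ ρ
        (fun θ => obsInfo f θ x - meanInfo ν f θ₀ θ) ≤ ENNReal.ofReal (Dp x)) ∧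
      (∀ᵐ x ∂(modelLaw ν f θ₀), supLambdaMax Θ θ₀ ρ
        (fun θ => meanInfo ν f θ₀ θ - obsInfo f θ x) ≤ ENNReal.ofReal (Dm x)) ∧
      ∫⁻ x, ENNReal.ofReal (Dm x) ∂(modelLaw ν f θ₀) ≤ ENNReal.ofReal e ∧
      ∫⁻ x, ENNReal.ofReal (Real.exp (Dp x)) ∂(modelLaw ν f θ₀) ≤
        ENNReal.ofReal (Real.exp e) := by
  obtain ⟨Dm, hm1, hm2, hm3⟩ := exists_measurable_real_version hc.aemeasurable_lower
    (ae_lt_top' hc.aemeasurable_lower (hc.lower.trans_lt ENNReal.ofReal_lt_top).ne)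
  have hexp := EReal.measurable_exp.comp_aemeasurable
    (measurable_coe_ennreal_ereal.comp_aemeasurable hc.aemeasurable_upper)
  obtain ⟨Dp, hp1, hp2, hp3⟩ := exists_measurable_real_version hc.aemeasurable_upper (by
    filter_upwards [ae_lt_top' hexp (hc.upper.trans_lt ENNReal.ofReal_lt_top).ne] with x hx
    simpa [lt_top_iff_ne_top] using hx)
  refine ⟨Dp, Dm, hp1, hm1, hp2, hm2, hp3.mono fun x hx => hx.le, hm3.mono fun x hx => hx.le,
    (lintegral_congr_ae hm3).symm.trans_le hc.lower, le_trans (le_of_eq ?_) hc.upper⟩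
  refine lintegral_congr_ae ?_
  filter_upwards [hp3] with x hx
  rw [hx, EReal.coe_ennreal_ofReal, max_eq_left (hp2 x), EReal.exp_coe]

end HessianConcentrationAt

lemma IsACSSRun.map_apply {Pr : Measure Ω} {X : Ω → S} {W : Ω → EuclideanSpace ℝ (Fin d)}
    {Xt : Fin M → Ω → S} (hrun : IsACSSRun ν f R σ θhat Pt θ₀ Pr X W Xt)
    {A : Set (Fin (M + 1) → S)} (hA : MeasurableSet A) :
    (Pr.map fun ω i => (Fin.cons X Xt : Fin (M + 1) → Ω → S) i ω) A =
      ∫⁻ p, copiesLaw f R σ θhat Pt p.1 p.2 {y | (Fin.cons p.1 y : Fin (M + 1) → S) ∈ A}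
        ∂((modelLaw ν f θ₀).prod (noiseLaw d)) := by
  have hfun : (fun ω i => (Fin.cons X Xt : Fin (M + 1) → Ω → S) i ω) =
      fun ω => (Fin.cons (X ω) fun m => Xt m ω : Fin (M + 1) → S) := by
    funext ω i
    refine Fin.cases ?_ (fun j => ?_) i <;> rfl
  have hm : Measurable fun q : (S × EuclideanSpace ℝ (Fin d)) × (Fin M → S) =>
      (Fin.cons q.1.1 q.2 : Fin (M + 1) → S) :=
    measurable_finCons.comp ((measurable_fst.comp measurable_fst).prodMk measurable_snd)
  have hω : Measurable fun ω => (Fin.cons (X ω) fun m => Xt m ω : Fin (M + 1) → S) :=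
    measurable_finCons.comp (hrun.measurable_data.prodMk
      (measurable_pi_lambda _ fun m => hrun.measurable_copies m))
  rw [hfun, Measure.map_apply hω hA]
  exact hrun.law_copies _ (hm hA)

lemma IsACSSRun.measurable_joint {Pr : Measure Ω} {X : Ω → S} {W : Ω → EuclideanSpace ℝ (Fin d)}
    {Xt : Fin M → Ω → S} (hrun : IsACSSRun ν f R σ θhat Pt θ₀ Pr X W Xt) :
    Measurable fun ω i => (Fin.cons X Xt : Fin (M + 1) → Ω → S) i ω := by
  refine measurable_pi_lambda _ fun i => ?_
  refine Fin.cases ?_ (fun j => ?_) i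
  · exact hrun.measurable_data
  · exact hrun.measurable_copies j

namespace RegularityConditions

variable {B : Set (EuclideanSpace ℝ (Fin d))}

lemma setLIntegral_dataWeight_eq (h : RegularityConditions Θ ν f R) (hd : 0 < d) (hσ : 0 < σ)
    (hmeas : Measurable (Function.uncurry θhat)) (hmem : ∀ x w, θhat x w ∈ Θ) (hθ₀ : θ₀ ∈ Θ)
    (hB : MeasurableSet B)
    {G : S → EuclideanSpace ℝ (Fin d) → EuclideanSpace ℝ (Fin d) → ℝ≥0∞}
    (hG : Measurable fun q : S × EuclideanSpace ℝ (Fin d) × EuclideanSpace ℝ (Fin d) =>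
      G q.1 q.2.1 q.2.2) :
    ∫⁻ θ in B, jacobianConst d σ * ∫⁻ x, dataWeight f R σ θhat θ₀ θ x *
        G x (impliedNoise f R σ x θ) θ ∂ν =
      ∫⁻ p in {p | IsSSOSP (perturbedLoss f R σ p.1 p.2) (θhat p.1 p.2)},
        B.indicator (G p.1 p.2) (θhat p.1 p.2) ∂((modelLaw ν f θ₀).prod (noiseLaw d)) := by
  have hGB : Measurable fun q : S × EuclideanSpace ℝ (Fin d) × EuclideanSpace ℝ (Fin d) =>
      B.indicator (G q.1 q.2.1) q.2.2 := by
    have := hG.indicator (measurable_snd.comp measurable_snd hB :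
      MeasurableSet {q : S × EuclideanSpace ℝ (Fin d) × EuclideanSpace ℝ (Fin d) | q.2.2 ∈ B})
    exact this
  rw [h.lintegral_prod_isSSOSP_eq hd hσ hmeas hmem hθ₀ (G := fun x w => B.indicator (G x w)) hGB,
    ← lintegral_indicator hB]
  refine lintegral_congr fun θ => ?_
  by_cases hθ : θ ∈ B
  · simp [hθ]
  · simp [hθ]

lemma setLIntegral_dataWeight_le (h : RegularityConditions Θ ν f R) (hd : 0 < d) (hσ : 0 < σ)
    (hmeas : Measurable (Function.uncurry θhat)) (hmem : ∀ x w, θhat x w ∈ Θ) (hθ₀ : θ₀ ∈ Θ)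
    (hB : MeasurableSet B) {G : S → EuclideanSpace ℝ (Fin d) → ℝ≥0∞}
    (hG : Measurable fun q : S × EuclideanSpace ℝ (Fin d) => G q.1 q.2) :
    ∫⁻ θ in B, jacobianConst d σ * ∫⁻ x, dataWeight f R σ θhat θ₀ θ x *
        G x (impliedNoise f R σ x θ) ∂ν ≤
      ∫⁻ p, G p.1 p.2 ∂((modelLaw ν f θ₀).prod (noiseLaw d)) := by
  rw [h.setLIntegral_dataWeight_eq hd hσ hmeas hmem hθ₀ hB (G := fun x w _ => G x w)
    (hG.comp (measurable_fst.prodMk (measurable_fst.comp measurable_snd)))]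
  refine (lintegral_mono fun p => ?_).trans (setLIntegral_le_lintegral _ _)
  exact Set.indicator_le_self' (fun _ _ => zero_le) _

lemma setLIntegral_totalWeight_le_one (h : RegularityConditions Θ ν f R) (hd : 0 < d)
    (hσ : 0 < σ) (hmeas : Measurable (Function.uncurry θhat)) (hmem : ∀ x w, θhat x w ∈ Θ)
    (hθ₀ : θ₀ ∈ Θ) (hB : MeasurableSet B) :
    ∫⁻ θ in B, jacobianConst d σ * totalWeight ν f R σ θhat θ₀ θ ≤ 1 := by
  have := h.isProbabilityMeasure θ₀ hθ₀
  have h1 := h.setLIntegral_dataWeight_le hd hσ hmeas hmem hθ₀ hB (G := fun _ _ => 1)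
    measurable_const
  simpa [totalWeight] using h1

lemma plugInMixture_univ_le_one (h : RegularityConditions Θ ν f R) (hd : 0 < d) (hσ : 0 < σ)
    (hmeas : Measurable (Function.uncurry θhat)) (hmem : ∀ x w, θhat x w ∈ Θ) (hθ₀ : θ₀ ∈ Θ)
    [IsMarkovKernel Pt] (hB : MeasurableSet B) (hBΘ : B ⊆ Θ) :
    plugInMixture ν f R σ θhat Pt θ₀ B Set.univ ≤ 1 := by
  rw [h.plugInMixture_apply hσ hmeas hmem hθ₀ B MeasurableSet.univ]
  refine le_trans ?_ (h.setLIntegral_totalWeight_le_one hd hσ hmeas hmem hθ₀ hB)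
  refine setLIntegral_mono' hB fun θ hθ => mul_le_mul_right ?_ _
  have hwm : Measurable (dataWeight f R σ θhat θ θ) :=
    (h.measurable_dataWeight hσ hmeas hmem (hBΘ hθ)).comp measurable_prodMk_right
  calc _ ≤ ∫⁻ x, totalWeight ν f R σ θhat θ₀ θ / totalWeight ν f R σ θhat θ θ *
        dataWeight f R σ θhat θ θ x ∂ν :=
        lintegral_mono fun x => mul_le_of_le_one_right' (sampleProb_le_one Pt _ x θ)
    _ ≤ totalWeight ν f R σ θhat θ₀ θ := by
        rw [lintegral_const_mul _ hwm, mul_comm]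
        exact ENNReal.mul_div_le

/-- On the event that the estimator lies in the ball of radius `ρ` around `θ₀`, replacing the true
conditional law of the data by the plug-in law loses little mass. -/
lemma setLIntegral_sampleProb_le (h : RegularityConditions Θ ν f R) (hd : 0 < d) (hσ : 0 < σ)
    (hmeas : Measurable (Function.uncurry θhat)) (hmem : ∀ x w, θhat x w ∈ Θ) (hθ₀ : θ₀ ∈ Θ)
    [IsMarkovKernel Pt] {ρ e : ℝ} (hρ : 0 ≤ ρ) (hs : σ * ρ ≤ 1 / 3)
    (hc : HessianConcentrationAt Θ ν f θ₀ ρ e) {A : Set (Fin (M + 1) → S)}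
    (hA : MeasurableSet A) :
    ∫⁻ θ in Metric.closedBall θ₀ ρ ∩ Θ, jacobianConst d σ *
        ∫⁻ x, dataWeight f R σ θhat θ₀ θ x * sampleProb Pt A x θ ∂ν ≤
      plugInMixture ν f R σ θhat Pt θ₀ (Metric.closedBall θ₀ ρ ∩ Θ) A +
        ENNReal.ofReal (5 / 2 * (σ * ρ) + e) := by
  have := h.sFinite hθ₀
  have := h.isProbabilityMeasure θ₀ hθ₀
  have he := hc.nonneg
  obtain ⟨Dp, Dm, hDpm, hDmm, hDp, hDm, hup, hlo, hElo, hEup⟩ := hc.exists_deviations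
  have hB : MeasurableSet (Metric.closedBall θ₀ ρ ∩ Θ) :=
    Metric.isClosed_closedBall.measurableSet.inter h.isOpen.measurableSet
  set κ : ℝ := Real.exp (5 / 4 * (σ * ρ) + e / 2) with hκ
  have hκ1 : 1 ≤ κ := Real.one_le_exp (by positivity)
  set Z : S → EuclideanSpace ℝ (Fin d) → ℝ≥0∞ := fun x w => ENNReal.ofReal (Real.log κ +
    Real.exp (σ * ρ * ‖w‖ + Dp x / 2) / κ - 1 + (σ * ρ * ‖w‖ + Dm x / 2)) with hZ
  have hZm : Measurable fun q : S × EuclideanSpace ℝ (Fin d) => Z q.1 q.2 := by fun_prop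
  have hsplit : ∀ θ ∈ Metric.closedBall θ₀ ρ ∩ Θ, jacobianConst d σ *
      ∫⁻ x, dataWeight f R σ θhat θ₀ θ x * sampleProb Pt A x θ ∂ν ≤
      jacobianConst d σ *
        ∫⁻ x, totalWeight ν f R σ θhat θ₀ θ / totalWeight ν f R σ θhat θ θ *
          dataWeight f R σ θhat θ θ x * sampleProb Pt A x θ ∂ν +
      jacobianConst d σ * ∫⁻ x, (dataWeight f R σ θhat θ₀ θ x -
        totalWeight ν f R σ θhat θ₀ θ / totalWeight ν f R σ θhat θ θ *
          dataWeight f R σ θhat θ θ x) ∂ν := by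
    intro θ hθ
    have hwm : Measurable (dataWeight f R σ θhat θ θ) :=
      (h.measurable_dataWeight hσ hmeas hmem hθ.2).comp measurable_prodMk_right
    have hKm : Measurable fun x => sampleProb Pt A x θ :=
      (measurable_sampleProb Pt hA).comp measurable_prodMk_right
    have hm : Measurable fun x => totalWeight ν f R σ θhat θ₀ θ / totalWeight ν f R σ θhat θ θ *
        dataWeight f R σ θhat θ θ x * sampleProb Pt A x θ := (hwm.const_mul _).mul hKm
    rw [← mul_add, ← lintegral_add_left hm]
    refine mul_le_mul_right (lintegral_mono fun x => ?_) _
    calc dataWeight f R σ θhat θ₀ θ x * sampleProb Pt A x θ ≤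
          (totalWeight ν f R σ θhat θ₀ θ / totalWeight ν f R σ θhat θ θ *
            dataWeight f R σ θhat θ θ x + (dataWeight f R σ θhat θ₀ θ x -
          totalWeight ν f R σ θhat θ₀ θ / totalWeight ν f R σ θhat θ θ *
            dataWeight f R σ θhat θ θ x)) * sampleProb Pt A x θ := by
          gcongr
          exact le_add_tsub
      _ ≤ _ := by
          rw [add_mul]
          gcongr
          exact mul_le_of_le_one_right' (sampleProb_le_one Pt A x θ)
  have hQm : Measurable fun θ => jacobianConst d σ *
      ∫⁻ x, totalWeight ν f R σ θhat θ₀ θ / totalWeight ν f R σ θhat θ θ *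
        dataWeight f R σ θhat θ θ x * sampleProb Pt A x θ ∂ν := by
    refine Measurable.const_mul (Measurable.lintegral_prod_left'
      (f := fun p : S × EuclideanSpace ℝ (Fin d) =>
        totalWeight ν f R σ θhat θ₀ p.2 / totalWeight ν f R σ θhat p.2 p.2 *
          dataWeight f R σ θhat p.2 p.2 p.1 * sampleProb Pt A p.1 p.2) ?_) _
    exact ((((h.measurable_totalWeight hσ hmeas hmem hθ₀).comp measurable_snd).div
      ((h.measurable_totalWeight_self hσ hmeas hmem hθ₀).comp measurable_snd)).mul
      (h.measurable_dataWeight_self hσ hmeas hmem)).mul (measurable_sampleProb Pt hA)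
  -- the conditional laws are defined for almost every value of the estimator
  have hfin : ∀ᵐ θ ∂(volume.restrict (Metric.closedBall θ₀ ρ ∩ Θ)),
      totalWeight ν f R σ θhat θ₀ θ ≠ ∞ := by
    have h1 := ae_lt_top ((h.measurable_totalWeight hσ hmeas hmem hθ₀).const_mul
      (jacobianConst d σ)) ((h.setLIntegral_totalWeight_le_one hd hσ hmeas hmem hθ₀
        hB).trans_lt ENNReal.one_lt_top).ne
    filter_upwards [h1] with θ hθ hθ'
    rw [hθ', ENNReal.mul_top (jacobianConst_ne_zero hd hσ)] at hθ
    exact lt_irrefl _ hθ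
  calc _ ≤ ∫⁻ θ in Metric.closedBall θ₀ ρ ∩ Θ, (jacobianConst d σ *
        ∫⁻ x, totalWeight ν f R σ θhat θ₀ θ / totalWeight ν f R σ θhat θ θ *
          dataWeight f R σ θhat θ θ x * sampleProb Pt A x θ ∂ν +
      jacobianConst d σ * ∫⁻ x, (dataWeight f R σ θhat θ₀ θ x -
        totalWeight ν f R σ θhat θ₀ θ / totalWeight ν f R σ θhat θ θ *
          dataWeight f R σ θhat θ θ x) ∂ν) := setLIntegral_mono' hB hsplit
    _ = plugInMixture ν f R σ θhat Pt θ₀ (Metric.closedBall θ₀ ρ ∩ Θ) A +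
        ∫⁻ θ in Metric.closedBall θ₀ ρ ∩ Θ, jacobianConst d σ *
          ∫⁻ x, (dataWeight f R σ θhat θ₀ θ x -
            totalWeight ν f R σ θhat θ₀ θ / totalWeight ν f R σ θhat θ θ *
              dataWeight f R σ θhat θ θ x) ∂ν := by
        rw [lintegral_add_left hQm, h.plugInMixture_apply hσ hmeas hmem hθ₀ _ hA]
    _ ≤ plugInMixture ν f R σ θhat Pt θ₀ (Metric.closedBall θ₀ ρ ∩ Θ) A +
        ∫⁻ θ in Metric.closedBall θ₀ ρ ∩ Θ, jacobianConst d σ *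
          ∫⁻ x, dataWeight f R σ θhat θ₀ θ x * Z x (impliedNoise f R σ x θ) ∂ν := by
        refine add_le_add_right (lintegral_mono_ae ?_) _
        filter_upwards [hfin, ae_restrict_mem hB] with θ hθfin hθ
        exact mul_le_mul_right (h.lintegral_dataWeight_sub_le hσ hmeas hmem hθ₀ hρ hθ hDpm hDmm
          hDp hDm hup hlo hκ1 hθfin) _
    _ ≤ _ := by
        refine add_le_add_right ?_ _
        exact (h.setLIntegral_dataWeight_le hd hσ hmeas hmem hθ₀ hB hZm).trans
          (lintegral_tiltBound_le hd _ hDpm hDmm hDp hDm (by positivity) hs he hElo hEup)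

/-- The law of `(X, copies)` exceeds the plug-in mixture by at most the tilting error, plus `δ` for
the event that the estimator is not a SSOSP near `θ₀`. -/
lemma map_run_le (h : RegularityConditions Θ ν f R) (hd : 0 < d) (hσ : 0 < σ)
    (hmeas : Measurable (Function.uncurry θhat)) (hmem : ∀ x w, θhat x w ∈ Θ) (hθ₀ : θ₀ ∈ Θ)
    [IsMarkovKernel Pt] {ρ e δ : ℝ} (hρ : 0 ≤ ρ) (hs : σ * ρ ≤ 1 / 3)
    (hc : HessianConcentrationAt Θ ν f θ₀ ρ e)
    (hacc : 1 - δ ≤ ((modelLaw ν f θ₀).prod (noiseLaw d)).real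
      {p | ‖θhat p.1 p.2 - θ₀‖ ≤ ρ ∧ IsSSOSP (perturbedLoss f R σ p.1 p.2) (θhat p.1 p.2)})
    {Pr : Measure Ω} {X : Ω → S} {W : Ω → EuclideanSpace ℝ (Fin d)} {Xt : Fin M → Ω → S}
    (hrun : IsACSSRun ν f R σ θhat Pt θ₀ Pr X W Xt) {A : Set (Fin (M + 1) → S)}
    (hA : MeasurableSet A) :
    (Pr.map fun ω i => (Fin.cons X Xt : Fin (M + 1) → Ω → S) i ω) A ≤
      plugInMixture ν f R σ θhat Pt θ₀ (Metric.closedBall θ₀ ρ ∩ Θ) A +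
        ENNReal.ofReal (5 / 2 * (σ * ρ) + e) + ENNReal.ofReal δ := by
  have := h.isProbabilityMeasure θ₀ hθ₀
  have hB : MeasurableSet (Metric.closedBall θ₀ ρ ∩ Θ) :=
    Metric.isClosed_closedBall.measurableSet.inter h.isOpen.measurableSet
  have hset := h.measurableSet_isSSOSP hσ hmeas hmem
  have hgood : MeasurableSet {p : S × EuclideanSpace ℝ (Fin d) | ‖θhat p.1 p.2 - θ₀‖ ≤ ρ ∧
      IsSSOSP (perturbedLoss f R σ p.1 p.2) (θhat p.1 p.2)} := by
    have hn : Measurable fun p : S × EuclideanSpace ℝ (Fin d) => ‖θhat p.1 p.2 - θ₀‖ :=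
      ((show Measurable fun p : S × EuclideanSpace ℝ (Fin d) => θhat p.1 p.2 from
        hmeas).sub_const _).norm
    exact (measurableSet_le hn measurable_const).inter hset
  have hbad : ((modelLaw ν f θ₀).prod (noiseLaw d))
      {p | ‖θhat p.1 p.2 - θ₀‖ ≤ ρ ∧
        IsSSOSP (perturbedLoss f R σ p.1 p.2) (θhat p.1 p.2)}ᶜ ≤ ENNReal.ofReal δ := by
    refine ENNReal.le_ofReal_iff_toReal_le (measure_ne_top _ _) ?_ |>.2 ?_
    · have : ((modelLaw ν f θ₀).prod (noiseLaw d)).real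
        {p | ‖θhat p.1 p.2 - θ₀‖ ≤ ρ ∧
          IsSSOSP (perturbedLoss f R σ p.1 p.2) (θhat p.1 p.2)} ≤ 1 := measureReal_le_one
      linarith
    · rw [← measureReal_def, probReal_compl_eq_one_sub hgood]
      linarith
  have hKm : Measurable fun q : S × EuclideanSpace ℝ (Fin d) × EuclideanSpace ℝ (Fin d) =>
      sampleProb Pt A q.1 q.2.2 :=
    (measurable_sampleProb Pt hA).comp
      (measurable_fst.prodMk (measurable_snd.comp measurable_snd))
  have hpt : ∀ p : S × EuclideanSpace ℝ (Fin d),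
      copiesLaw f R σ θhat Pt p.1 p.2 {y | (Fin.cons p.1 y : Fin (M + 1) → S) ∈ A} ≤
        Set.indicator {p | IsSSOSP (perturbedLoss f R σ p.1 p.2) (θhat p.1 p.2)}
          (fun p => (Metric.closedBall θ₀ ρ ∩ Θ).indicator (sampleProb Pt A p.1)
            (θhat p.1 p.2)) p +
        Set.indicator {p | ‖θhat p.1 p.2 - θ₀‖ ≤ ρ ∧
          IsSSOSP (perturbedLoss f R σ p.1 p.2) (θhat p.1 p.2)}ᶜ (fun _ => 1) p := by
    intro p
    by_cases hp : ‖θhat p.1 p.2 - θ₀‖ ≤ ρ ∧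
      IsSSOSP (perturbedLoss f R σ p.1 p.2) (θhat p.1 p.2)
    · have hin : θhat p.1 p.2 ∈ Metric.closedBall θ₀ ρ ∩ Θ :=
        ⟨mem_closedBall_iff_norm.2 hp.1, hmem _ _⟩
      refine le_trans (le_of_eq ?_) le_self_add
      rw [Set.indicator_of_mem (show p ∈ {p : S × EuclideanSpace ℝ (Fin d) |
        IsSSOSP (perturbedLoss f R σ p.1 p.2) (θhat p.1 p.2)} from hp.2),
        Set.indicator_of_mem hin, copiesLaw, if_pos hp.2,
        sampleProb]
    · refine le_trans ?_ le_add_self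
      rw [Set.indicator_of_mem (show p ∈ {p : S × EuclideanSpace ℝ (Fin d) |
        ‖θhat p.1 p.2 - θ₀‖ ≤ ρ ∧
          IsSSOSP (perturbedLoss f R σ p.1 p.2) (θhat p.1 p.2)}ᶜ from hp)]
      unfold copiesLaw
      split_ifs <;> exact prob_le_one
  rw [hrun.map_apply hA]
  refine (lintegral_mono hpt).trans ?_
  rw [lintegral_add_right _ (measurable_const.indicator hgood.compl),
    lintegral_indicator hset, lintegral_indicator_const hgood.compl, one_mul,
    ← h.setLIntegral_dataWeight_eq hd hσ hmeas hmem hθ₀ hB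
      (G := fun x _ θ => sampleProb Pt A x θ) hKm]
  exact add_le_add (h.setLIntegral_sampleProb_le hd hσ hmeas hmem hθ₀ hρ hs hc hA) hbad

/-- An exchangeable law that dominates the law of `(X, copies)` up to the claimed error on every
event: the plug-in mixture, completed to a probability measure by constant vectors. -/
lemma exists_isExchangeable_forall_le (h : RegularityConditions Θ ν f R) (hd : 0 < d)
    (hσ : 0 < σ) (hmeas : Measurable (Function.uncurry θhat)) (hmem : ∀ x w, θhat x w ∈ Θ)
    (hθ₀ : θ₀ ∈ Θ) [IsMarkovKernel Pt] (hPt : SamplerExchangeable Θ ν f R σ θhat Pt)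
    {ρ e δ : ℝ} (hρ : 0 ≤ ρ) (hc : HessianConcentrationAt Θ ν f θ₀ ρ e)
    (hacc : 1 - δ ≤ ((modelLaw ν f θ₀).prod (noiseLaw d)).real
      {p | ‖θhat p.1 p.2 - θ₀‖ ≤ ρ ∧ IsSSOSP (perturbedLoss f R σ p.1 p.2) (θhat p.1 p.2)})
    {Pr : Measure Ω} [IsProbabilityMeasure Pr] {X : Ω → S} {W : Ω → EuclideanSpace ℝ (Fin d)}
    {Xt : Fin M → Ω → S} (hrun : IsACSSRun ν f R σ θhat Pt θ₀ Pr X W Xt) :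
    ∃ Q : Measure (Fin (M + 1) → S), IsProbabilityMeasure Q ∧ IsExchangeable Q ∧
      ∀ A, MeasurableSet A →
        (Pr.map fun ω i => (Fin.cons X Xt : Fin (M + 1) → Ω → S) i ω).real A ≤
          Q.real A + (3 * σ * ρ + δ + e) := by
  have := h.isProbabilityMeasure θ₀ hθ₀
  have hPprob : IsProbabilityMeasure
      (Pr.map fun ω i => (Fin.cons X Xt : Fin (M + 1) → Ω → S) i ω) :=
    Measure.isProbabilityMeasure_map hrun.measurable_joint.aemeasurable
  have he := hc.nonneg
  have hδ : 0 ≤ δ := by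
    have : ((modelLaw ν f θ₀).prod (noiseLaw d)).real
      {p | ‖θhat p.1 p.2 - θ₀‖ ≤ ρ ∧
        IsSSOSP (perturbedLoss f R σ p.1 p.2) (θhat p.1 p.2)} ≤ 1 := measureReal_le_one
    linarith
  have hsρ : 0 ≤ σ * ρ := by positivity
  have hconst : IsProbabilityMeasure ((modelLaw ν f θ₀).map fun x (_ : Fin (M + 1)) => x) :=
    Measure.isProbabilityMeasure_map (by fun_prop)
  have hconstE := isExchangeable_map_const (k := M + 1) (modelLaw ν f θ₀)
  rcases le_or_gt (σ * ρ) (1 / 3) with hs | hs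
  swap
  · -- the claimed bound exceeds one
    refine ⟨_, hconst, hconstE, fun A _ => ?_⟩
    have h1 : (Pr.map fun ω i => (Fin.cons X Xt : Fin (M + 1) → Ω → S) i ω).real A ≤ 1 :=
      measureReal_le_one
    have h2 : 0 ≤ ((modelLaw ν f θ₀).map fun x (_ : Fin (M + 1)) => x).real A :=
      measureReal_nonneg
    linarith
  have hB : MeasurableSet (Metric.closedBall θ₀ ρ ∩ Θ) :=
    Metric.isClosed_closedBall.measurableSet.inter h.isOpen.measurableSet
  set Q₁ := plugInMixture ν f R σ θhat Pt θ₀ (Metric.closedBall θ₀ ρ ∩ Θ) with hQ₁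
  have hmass : Q₁ Set.univ ≤ 1 :=
    h.plugInMixture_univ_le_one hd hσ hmeas hmem hθ₀ hB Set.inter_subset_right
  have hQ₁E : IsExchangeable Q₁ :=
    h.isExchangeable_plugInMixture hσ hmeas hmem hθ₀ hPt hB Set.inter_subset_right
  set Q := Q₁ + (1 - Q₁ Set.univ) • (modelLaw ν f θ₀).map fun x (_ : Fin (M + 1)) => x with hQ
  have hQprob : IsProbabilityMeasure Q := ⟨by
    rw [hQ, Measure.add_apply, Measure.smul_apply, hconst.measure_univ, smul_eq_mul, mul_one,
      add_tsub_cancel_of_le hmass]⟩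
  refine ⟨Q, hQprob, fun π => ?_, fun A hA => ?_⟩
  · rw [hQ, Measure.map_add _ _ (by fun_prop), Measure.map_smul, hQ₁E π, hconstE π]
  · have hle := h.map_run_le hd hσ hmeas hmem hθ₀ hρ hs hc hacc hrun hA
    have hle' : (Pr.map fun ω i => (Fin.cons X Xt : Fin (M + 1) → Ω → S) i ω) A ≤
        Q A + ENNReal.ofReal (3 * σ * ρ + δ + e) := by
      refine hle.trans ?_
      rw [add_assoc, ← ENNReal.ofReal_add (by positivity) hδ]
      refine add_le_add ?_ (ENNReal.ofReal_le_ofReal (by linarith))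
      rw [hQ, Measure.add_apply]
      exact le_self_add
    have htop : Q A + ENNReal.ofReal (3 * σ * ρ + δ + e) ≠ ∞ :=
      ENNReal.add_ne_top.2 ⟨measure_ne_top _ _, ENNReal.ofReal_ne_top⟩
    have := ENNReal.toReal_mono htop hle'
    rwa [ENNReal.toReal_add (measure_ne_top _ _) ENNReal.ofReal_ne_top,
      ENNReal.toReal_ofReal (by positivity)] at this

end RegularityConditions

end Distance

theorem theorem1 {d : ℕ} (hd : 0 < d) {S Ω : Type*} [MeasurableSpace S] [MeasurableSpace Ω]
    (Θ : Set (EuclideanSpace ℝ (Fin d))) (ν : Measure S)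
    (f : EuclideanSpace ℝ (Fin d) → S → ℝ) (R : EuclideanSpace ℝ (Fin d) → ℝ)
    (σ : ℝ) (hσ : 0 < σ)
    (θhat : S → EuclideanSpace ℝ (Fin d) → EuclideanSpace ℝ (Fin d))
    (hθhat_meas : Measurable (Function.uncurry θhat))
    (hθhat_mem : ∀ x w, θhat x w ∈ Θ)
    (r δ ε : EuclideanSpace ℝ (Fin d) → ℝ) (hr : ∀ θ ∈ Θ, 0 < r θ)
    (hreg : RegularityConditions Θ ν f R)
    (hest : EstimatorAccurate Θ ν f R σ θhat r δ)
    (hhess : ∀ θ₀ ∈ Θ, HessianConcentrationAt Θ ν f θ₀ (r θ₀) (ε θ₀))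
    (M : ℕ) (Pt : Kernel (S × EuclideanSpace ℝ (Fin d)) (Fin M → S)) [IsMarkovKernel Pt]
    (hPt : SamplerExchangeable Θ ν f R σ θhat Pt)
    (θ₀ : EuclideanSpace ℝ (Fin d)) (hθ₀ : θ₀ ∈ Θ)
    (Pr : Measure Ω) [IsProbabilityMeasure Pr]
    (X : Ω → S) (W : Ω → EuclideanSpace ℝ (Fin d)) (Xt : Fin M → Ω → S)
    (hrun : IsACSSRun ν f R σ θhat Pt θ₀ Pr X W Xt) :
    dExch Pr (Fin.cons X Xt : Fin (M + 1) → Ω → S) ≤ 3 * σ * r θ₀ + δ θ₀ + ε θ₀ ∧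
      ∀ T : S → ℝ, Measurable T → ∀ α ∈ Set.Icc (0 : ℝ) 1,
        Pr.real {ω | pval T (X ω) (fun m => Xt m ω) ≤ α} ≤
          α + 3 * σ * r θ₀ + δ θ₀ + ε θ₀ := by
  have hρ := hr θ₀ hθ₀
  obtain ⟨Q, hQprob, hQE, hQ⟩ := hreg.exists_isExchangeable_forall_le hd hσ hθhat_meas hθhat_mem
    hθ₀ hPt hρ.le (hhess θ₀ hθ₀) (hest θ₀ hθ₀) hrun
  have hPprob : IsProbabilityMeasure
      (Pr.map fun ω i => (Fin.cons X Xt : Fin (M + 1) → Ω → S) i ω) :=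
    Measure.isProbabilityMeasure_map hrun.measurable_joint.aemeasurable
  refine ⟨dExch_le hQE (tvDist_le_of_forall_le hQ), fun T hT α hα => ?_⟩
  have hset : MeasurableSet {b : Fin (M + 1) → S | pval T (b 0) (fun m => b m.succ) ≤ α} := by
    simp_rw [pval_eq_rankCount]
    exact measurableSet_le ((measurable_rankCount hT 0).div_const _) measurable_const
  have h1 := hQ _ hset
  rw [map_measureReal_apply hrun.measurable_joint hset] at h1
  have h2 := hQE.measureReal_pval_le hT hα.1
  have h3 : Pr.real {ω | pval T (X ω) (fun m => Xt m ω) ≤ α} =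
      Pr.real ((fun ω i => (Fin.cons X Xt : Fin (M + 1) → Ω → S) i ω) ⁻¹'
        {b | pval T (b 0) (fun m => b m.succ) ≤ α}) := rfl
  rw [h3]
  linarith
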